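/- Let $x:[0,1]\to[0,1]$ be the horizontal component of the Peano curve: if $t=\sum_{j\ge1}t_j3^{-j}$ with $t_j\in\{0,1,2\}$ and $k(n)=2-n$, then the ternary digits of $x(t)$ are, in order, $k^{0}(t_1),\,k^{t_2}(t_3),\,k^{t_2+t_4}(t_5),\,k^{t_2+t_4+t_6}(t_7),\dots$, where $k^v$ is the $v$-th iterate of $k$ (the value does not depend on the expansion of $t$ chosen). For $p>0$ put $$C_p=3^{\lfloor-\log_3p\rfloor}p\Bigl(1-\tfrac34\,3^{\lfloor-\log_3p\rfloor}p\Bigr),\qquad \varphi(c)=\frac{c}{C_c}\quad(c>0).$$ For $0\le t\le1$ and $c>0$ let $TV(x,[0,t],c)$ be the supremum of $\sum_i\max(|x(u_{i+1})-x(u_i)|-c,0)$ over finite partitions $0=u_0\le u_1\le\dots\le u_n=t$ (truncated variation). For $z\in\mathbb R$, $c>0$ let $\sigma_0=0$, $\tau_n=\inf\{u\in[\sigma_n,t]:x(u)\ge z+c/2\}$, $\sigma_{n+1}=\inf\{u\in[\tau_n,t]:x(u)<z-c/2\}$ (with $\inf\emptyset=+\infty$, $[+\infty,t]=\emptyset$),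 let $d^{z,c}(x,[0,t])=\max\{n:\sigma_n\le t\}$ be the number of downcrossings, and let $n^{z,c}(x,[0,t])=d^{z,c}(x,[0,t])+d^{-z,c}(-x,[0,t])$ be the number of crossings of $[z-c/2,z+c/2]$ by $x$ on $[0,t]$. A local time of $x$ is a function $L:[0,1]\times\mathbb R\to[0,\infty)$, $(t,z)\mapsto L_t^z$, such that for every $t\in[0,1]$ the function $z\mapsto L_t^z$ is Borel measurable and integrable and $\int_0^tg(x(s))\,ds=\int_{\mathbb R}g(z)L_t^z\,dz$ for all bounded Borel $g:\mathbb R\to\mathbb R$. Then: 1. For $c\in(0,1)$, $\varphi(c)=\bigl(3^{\lfloor-\log_3c\rfloor}(1-\tfrac34\,3^{\lfloor-\log_3c\rfloor}c)\bigr)^{-1}\ge0$; $\lim_{c\to0+}\varphi(c)=0$; $C_{3^kp}=C_p$ for all $p>0$, $k\in\mathbb Z$; and $\varphi$ is not differentiable at $3^{-n}$, $n=1,2,\dots$. 2. For every $p>0$ and $t\in[0,1]$, $\displaystyle\lim_{n\to\infty}3^{-n}p\;TV(x,[0,t],3^{-n}p)=C_p\,t$. 3. For every continuous $g:\mathbb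 R\to\mathbb R$, $t\in[0,1]$ and $c>0$ the function $z\mapsto n^{z,c}(x,[0,t])g(z)$ is integrable, and for every $p>0$, uniformly in $t\in[0,1]$, $$\lim_{n\to\infty}3^{-n}p\int_{\mathbb R}n^{z,3^{-n}p}(x,[0,t])\,g(z)\,dz=C_p\int_0^tg(x(s))\,ds.$$ 4. A local time of $x$ exists, and for every local time $L$ of $x$, every continuous $g:\mathbb R\to\mathbb R$ and every $t\in[0,1]$, $z\mapsto L_t^zg(z)$ is integrable and $$\lim_{c\to0+}\int_{\mathbb R}\varphi(c)\,n^{z,c}(x,[0,t])\,g(z)\,dz=\int_{\mathbb R}L_t^z\,g(z)\,dz.$$ -/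

import Mathlib

open MeasureTheory Filter Topology Set
open scoped ENNReal

noncomputable section

/-- Ternary digits of `t ∈ [0,1]`; the `j`-th entry (counted from `0`) is the digit
`t_{j+1}`, so that `t = ∑ j, peanoDigit t j * 3 ^ (-(j+1))`. The number `1` is `0.222…`. -/
def peanoDigit (t : ℝ) (j : ℕ) : Fin 3 :=
  if t = 1 then 2 else Real.digits t 3 j

/-- The horizontal component of the Peano curve,
`x(t) = 0.₃ k⁰(t₁) k^{t₂}(t₃) k^{t₂+t₄}(t₅) …` with `k(n) = 2 - n` on `{0,1,2}`
(`Fin.rev` on `Fin 3`). -/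
def peanoX (t : ℝ) : ℝ :=
  Real.ofDigits (b := 3) fun n =>
    (Fin.rev^[∑ i ∈ Finset.range n, (peanoDigit t (2 * i + 1) : ℕ)]) (peanoDigit t (2 * n))

/-- Truncated variation of `f` on `[s,t]` with truncation parameter `c`: the supremum over all
finite partitions `s = u 0 ≤ u 1 ≤ … ≤ u n = t` of `∑ max (|f (u (i+1)) - f (u i)| - c) 0`. -/
def truncatedVariation (f : ℝ → ℝ) (s t c : ℝ) : ℝ≥0∞ :=
  ⨆ (n : ℕ) (u : ℕ → ℝ) (_ : Monotone u ∧ u 0 = s ∧ u n = t),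
    ∑ i ∈ Finset.range n, ENNReal.ofReal (max (|f (u (i + 1)) - f (u i)| - c) 0)

/-- First time `u ∈ [a,t]` with `z + c/2 ≤ f u` (`⊤` if there is none). -/
def hitAbove (f : ℝ → ℝ) (z c t : ℝ) (a : EReal) : EReal :=
  sInf ((fun u : ℝ => (u : EReal)) '' {u : ℝ | a ≤ (u : EReal) ∧ u ≤ t ∧ z + c / 2 ≤ f u})

/-- Infimum of the times `u ∈ [a,t]` with `f u < z - c/2` (`⊤` if there is none). -/
def hitBelow (f : ℝ → ℝ) (z c t : ℝ) (a : EReal) : EReal :=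
  sInf ((fun u : ℝ => (u : EReal)) '' {u : ℝ | a ≤ (u : EReal) ∧ u ≤ t ∧ f u < z - c / 2})

/-- The times `σ_n`: `σ_0 = s`, `τ_n = hitAbove σ_n`, `σ_{n+1} = hitBelow τ_n`. -/
def downcrossingTime (f : ℝ → ℝ) (z c s t : ℝ) : ℕ → EReal
  | 0 => (s : EReal)
  | n + 1 => hitBelow f z c t (hitAbove f z c t (downcrossingTime f z c s t n))

/-- Number of downcrossings of `[z - c/2, z + c/2]` by `f` on `[s,t]`: `max {n | σ_n ≤ t}`. -/
def downcrossings (f : ℝ → ℝ) (z c s t : ℝ) : ℕ :=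
  sSup {n : ℕ | downcrossingTime f z c s t n ≤ (t : EReal)}

/-- Number of upcrossings of `[z - c/2, z + c/2]` by `f` on `[s,t]`. -/
def upcrossings (f : ℝ → ℝ) (z c s t : ℝ) : ℕ :=
  downcrossings (fun u => -f u) (-z) c s t

/-- Number of crossings of `[z - c/2, z + c/2]` by `f` on `[s,t]`. -/
def crossings (f : ℝ → ℝ) (z c s t : ℝ) : ℕ :=
  upcrossings f z c s t + downcrossings f z c s t

/-- `L t z`, `t ∈ [0,1]`, is a local time of `f : [0,1] → ℝ` with respect to Lebesgue measure,
that is, a density of the occupation measure of `f` on `[0,t]`. -/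
structure IsLocalTime (f : ℝ → ℝ) (L : ℝ → ℝ → ℝ) : Prop where
  nonneg : ∀ t ∈ Icc (0 : ℝ) 1, ∀ z, 0 ≤ L t z
  measurable : ∀ t ∈ Icc (0 : ℝ) 1, Measurable (L t)
  integrable : ∀ t ∈ Icc (0 : ℝ) 1, Integrable (L t) volume
  occupation : ∀ t ∈ Icc (0 : ℝ) 1, ∀ g : ℝ → ℝ, Measurable g → (∃ B, ∀ z, |g z| ≤ B) →
    ∫ s in (0 : ℝ)..t, g (f s) = ∫ z, g z * L t z

/-- `3 ^ ⌊-log₃ p⌋`. -/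
def peanoScale (p : ℝ) : ℝ := (3 : ℝ) ^ ⌊-Real.logb 3 p⌋

/-- `C_p = 3^{⌊-log₃ p⌋} p (1 - (3/4) 3^{⌊-log₃ p⌋} p)`. -/
def peanoC (p : ℝ) : ℝ := peanoScale p * p * (1 - 3 / 4 * (peanoScale p * p))

/-- The normalization `φ(c) = c / C_c`. -/
def peanoPhi (c : ℝ) : ℝ := c / peanoC c

end

/-!
The coordinate `x` consists of nine copies of itself: on each interval `[i / 9, (i + 1) / 9]` it is
`x / 3`, up to a translation and a reflection. At six of the eight junctions of these cells `x` has
a local extremum, and at the other two, `1 / 3` and `2 / 3`, it passes upwards from one third of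
its range to the next. Cutting at an extremum changes neither the number of crossings nor the sums
`∑ (|Δx| - c)`, whereas joining the two sides of such a passage gains one interval of length `c`.
The mean number `∫ n^{z,c} dz` of crossings of `x` on `[0, 1]` therefore satisfies
`T(c) ≤ 3 T(3c) + 2c`, while the sums over partitions transported to the nine cells satisfy the
reverse inequality. Starting from `T(c) = 1 - c` for `1/3 < c ≤ 1`, both lead to the value
`C_c / c - c / 4`, and since the mean number of crossings dominates the truncated variation, the
two coincide.

On the cells of a fine subdivision a continuous weight `g(x)` is nearly constant, which turns the
formula for `[0, 1]` into the limits for `[0, t]`. The nine cells also show that `x` maps Lebesgue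
measure on `[0, 1]` to itself, so that its occupation measures are absolutely continuous, and their
densities are a local time.
-/

/-! ### Self-similarity of the Peano coordinate -/

theorem ofDigits_rev (d : ℕ → Fin 3) :
    Real.ofDigits (fun n => (d n).rev) = 1 - Real.ofDigits d := by
  have digits_add (k : Fin 3) : ((k.rev : ℕ) : ℝ) + (k : ℕ) = ((2 : Fin 3) : ℕ) := by
    fin_cases k <;> norm_num [Fin.rev]
  have ofDigits_two : Real.ofDigits (fun _ => (2 : Fin 3)) = 1 := Real.ofDigits_const_last_eq_one 2
  rw [eq_sub_iff_add_eq, ← ofDigits_two]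
  unfold Real.ofDigits
  rw [← Real.summable_ofDigitsTerm.tsum_add Real.summable_ofDigitsTerm]
  congr 1
  ext n
  simp only [Real.ofDigitsTerm]
  rw [← add_mul, digits_add]

theorem ofDigits_iterate_rev (d : ℕ → Fin 3) {b : ℕ} (hb : b < 3) :
    Real.ofDigits (fun n => Fin.rev^[b] (d n)) =
      if b = 1 then 1 - Real.ofDigits d else Real.ofDigits d := by
  interval_cases b
  · simp
  · simpa using ofDigits_rev d
  · simp

section Digits

variable {a b : ℕ} {s : ℝ}

theorem subcell_ne_one (ha : a < 3) (hb : b < 3) (hs : s < 1) : (3 * a + b + s) / 9 ≠ 1 := by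
  have : (a : ℝ) ≤ 2 := by exact_mod_cast Nat.le_of_lt_succ ha
  have : (b : ℝ) ≤ 2 := by exact_mod_cast Nat.le_of_lt_succ hb
  intro h
  linarith

theorem peanoDigit_subcell_zero (ha : a < 3) (hb : b < 3) (hs : s ∈ Ico (0 : ℝ) 1) :
    peanoDigit ((3 * a + b + s) / 9) 0 = Fin.ofNat 3 a := by
  obtain ⟨h0, h1⟩ := hs
  have : (b : ℝ) ≤ 2 := by exact_mod_cast Nat.le_of_lt_succ hb
  have : (0 : ℝ) ≤ b := b.cast_nonneg
  rw [peanoDigit, if_neg (subcell_ne_one ha hb h1), Real.digits]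
  congr 1
  rw [Nat.floor_eq_iff (by positivity)]
  push_cast
  constructor <;> linarith

theorem digits_subcell_succ (hs : 0 ≤ s) (j : ℕ) :
    (Real.digits ((3 * a + b + s) / 9) 3 (j + 1) : ℕ) = (b * 3 ^ j + ⌊s * 3 ^ j⌋₊) % 3 := by
  have shift : (3 * a + b + s) / 9 * ((3 : ℕ) : ℝ) ^ (j + 1 + 1) =
      s * 3 ^ j + ((3 * a + b) * 3 ^ j : ℕ) := by
    push_cast; ring
  rw [Real.digits, shift, Nat.floor_add_natCast (by positivity), Fin.val_ofNat]
  rw [show ⌊s * 3 ^ j⌋₊ + (3 * a + b) * 3 ^ j =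
    (b * 3 ^ j + ⌊s * 3 ^ j⌋₊) + 3 * (a * 3 ^ j) by ring, Nat.add_mul_mod_self_left]

theorem peanoDigit_subcell_one (ha : a < 3) (hb : b < 3) (hs : s ∈ Ico (0 : ℝ) 1) :
    (peanoDigit ((3 * a + b + s) / 9) 1 : ℕ) = b := by
  rw [peanoDigit, if_neg (subcell_ne_one ha hb hs.2)]
  exact (digits_subcell_succ hs.1 0).trans <| by
    simp [Nat.floor_eq_zero.2 hs.2, Nat.mod_eq_of_lt hb]

theorem peanoDigit_subcell_add_two (ha : a < 3) (hb : b < 3) (hs : s ∈ Ico (0 : ℝ) 1) (j : ℕ) :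
    peanoDigit ((3 * a + b + s) / 9) (j + 2) = peanoDigit s j := by
  rw [peanoDigit, peanoDigit, if_neg (subcell_ne_one ha hb hs.2), if_neg hs.2.ne]
  ext
  rw [digits_subcell_succ hs.1 (j + 1), show b * 3 ^ (j + 1) + ⌊s * 3 ^ (j + 1)⌋₊ =
    ⌊s * 3 ^ (j + 1)⌋₊ + 3 * (b * 3 ^ j) by ring, Nat.add_mul_mod_self_left]
  simp [Real.digits]

theorem peanoX_mem_Icc (t : ℝ) : peanoX t ∈ Icc (0 : ℝ) 1 :=
  ⟨Real.ofDigits_nonneg _, Real.ofDigits_le_one _⟩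

theorem peanoX_one : peanoX 1 = 1 := by
  have iterate_rev_two (n : ℕ) : (Fin.rev^[∑ _i ∈ Finset.range n, 2]) (2 : Fin 3) = 2 := by
    induction n with
    | zero => rfl
    | succ n ih =>
      rw [Finset.sum_range_succ, Function.iterate_add_apply]
      exact ih
  have ofDigits_two : Real.ofDigits (fun _ => (2 : Fin 3)) = 1 := Real.ofDigits_const_last_eq_one 2
  refine Eq.trans ?_ ofDigits_two
  unfold peanoX
  congr 1
  ext n
  simp only [peanoDigit, if_true]
  exact congrArg Fin.val (iterate_rev_two n)

theorem peanoX_subcell_of_lt (ha : a < 3) (hb : b < 3) (hs : s ∈ Ico (0 : ℝ) 1) :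
    peanoX ((3 * a + b + s) / 9) = (a + if b = 1 then 1 - peanoX s else peanoX s) / 3 := by
  have tail_digits : (fun n => (Fin.rev^[∑ i ∈ Finset.range (n + 1),
      (peanoDigit ((3 * a + b + s) / 9) (2 * i + 1) : ℕ)])
        (peanoDigit ((3 * a + b + s) / 9) (2 * (n + 1)))) =
      fun n => Fin.rev^[b] ((Fin.rev^[∑ i ∈ Finset.range n, (peanoDigit s (2 * i + 1) : ℕ)])
        (peanoDigit s (2 * n))) := by
    funext n
    rw [← Function.iterate_add_apply, Finset.sum_range_succ', mul_zero, zero_add,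
      peanoDigit_subcell_one ha hb hs, show 2 * (n + 1) = 2 * n + 2 by ring,
      peanoDigit_subcell_add_two ha hb hs, add_comm b]
    simp only [show ∀ i, 2 * (i + 1) + 1 = 2 * i + 1 + 2 by intro i; ring,
      peanoDigit_subcell_add_two ha hb hs]
  rw [peanoX, Real.ofDigits_eq_sum_add_ofDigits _ 1, tail_digits, ofDigits_iterate_rev _ hb]
  simp only [Finset.range_one, Finset.sum_singleton, Real.ofDigitsTerm, Finset.range_zero,
    Finset.sum_empty, Function.iterate_zero, id, mul_zero, peanoDigit_subcell_zero ha hb hs,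
    Fin.val_ofNat, Nat.mod_eq_of_lt ha]
  change _ + _ * (if b = 1 then 1 - peanoX s else peanoX s) = _
  push_cast
  ring

theorem peanoX_zero : peanoX 0 = 0 := by
  have h := peanoX_subcell_of_lt (a := 0) (b := 0) (s := 0) (by norm_num) (by norm_num)
    (by norm_num)
  norm_num at h
  linarith

theorem peanoX_subcell (ha : a < 3) (hb : b < 3) (hs : s ∈ Icc (0 : ℝ) 1) :
    peanoX ((3 * a + b + s) / 9) = (a + if b = 1 then 1 - peanoX s else peanoX s) / 3 := by
  rcases hs.2.lt_or_eq with h | rfl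
  · exact peanoX_subcell_of_lt ha hb ⟨hs.1, h⟩
  have h0 : (0 : ℝ) ∈ Ico (0 : ℝ) 1 := by norm_num
  by_cases hb2 : b + 1 < 3
  · rw [show (3 * a + b + 1 : ℝ) / 9 = (3 * a + (b + 1 : ℕ) + 0) / 9 by push_cast; ring,
      peanoX_subcell_of_lt ha hb2 h0, peanoX_zero, peanoX_one]
    obtain rfl | rfl : b = 0 ∨ b = 1 := by omega
    all_goals norm_num
  obtain rfl : b = 2 := by omega
  by_cases ha2 : a + 1 < 3
  · rw [show (3 * a + (2 : ℕ) + 1 : ℝ) / 9 = (3 * (a + 1 : ℕ) + (0 : ℕ) + 0) / 9 by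
      push_cast; ring, peanoX_subcell_of_lt ha2 (by norm_num) h0, peanoX_zero, peanoX_one]
    norm_num
  obtain rfl : a = 2 := by omega
  norm_num [peanoX_one]

end Digits

theorem exists_nat_add_mem_Icc {M : ℕ} (hM : 0 < M) {w : ℝ} (hw : w ∈ Icc (0 : ℝ) M) :
    ∃ i < M, w - i ∈ Icc (0 : ℝ) 1 := by
  rcases hw.2.lt_or_eq with h | rfl
  · exact ⟨⌊w⌋₊, (Nat.floor_lt hw.1).2 h, by linarith [Nat.floor_le hw.1],
      by linarith [Nat.lt_floor_add_one w]⟩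
  · refine ⟨M - 1, by omega, ?_⟩
    rw [Nat.cast_sub (by omega)]
    norm_num

theorem peanoX_natCast_div_three {a : ℕ} (ha : a ≤ 3) : peanoX (a / 3) = a / 3 := by
  rcases ha.lt_or_eq with ha | rfl
  · have h := peanoX_subcell ha (b := 0) (s := 0) (by norm_num) (by norm_num)
    rw [show (3 * a + (0 : ℕ) + 0 : ℝ) / 9 = a / 3 by push_cast; ring, peanoX_zero] at h
    simpa using h
  · norm_num [peanoX_one]

section Columns

variable {a : ℕ} {t : ℝ}

theorem peanoX_mem_column (ha : a < 3) (ht : t ∈ Icc ((a : ℝ) / 3) ((a + 1) / 3)) :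
    peanoX t ∈ Icc ((a : ℝ) / 3) ((a + 1) / 3) := by
  obtain ⟨b, hb, hs⟩ := exists_nat_add_mem_Icc (M := 3) (by norm_num) (w := 9 * t - 3 * a)
    ⟨by linarith [ht.1], by push_cast; linarith [ht.2]⟩
  have h := peanoX_subcell ha hb hs
  rw [show (3 * a + b + (9 * t - 3 * a - b)) / 9 = t by ring] at h
  obtain ⟨h0, h1⟩ := peanoX_mem_Icc (9 * t - 3 * a - b)
  rw [h]
  split_ifs <;> constructor <;> linarith

theorem exists_mem_column (ht : t ∈ Icc (0 : ℝ) 1) :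
    ∃ a : ℕ, a < 3 ∧ t ∈ Icc ((a : ℝ) / 3) ((a + 1) / 3) := by
  obtain ⟨a, ha, h⟩ := exists_nat_add_mem_Icc (M := 3) (by norm_num) (w := 3 * t)
    ⟨by linarith [ht.1], by push_cast; linarith [ht.2]⟩
  exact ⟨a, ha, by linarith [h.1], by linarith [h.2]⟩

theorem peanoX_le_of_mem_Icc (ha : a ≤ 3) (ht : t ∈ Icc 0 ((a : ℝ) / 3)) :
    peanoX t ≤ a / 3 := by
  have ha' : (a : ℝ) ≤ 3 := by exact_mod_cast ha
  obtain ⟨k, hk, hkt⟩ := exists_mem_column ⟨ht.1, ht.2.trans (by linarith)⟩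
  rcases Nat.lt_or_ge k a with hka | hak
  · have : (k : ℝ) + 1 ≤ a := by exact_mod_cast hka
    linarith [(peanoX_mem_column hk hkt).2]
  · have : (a : ℝ) ≤ k := by exact_mod_cast hak
    rw [show t = a / 3 by linarith [hkt.1, ht.2], peanoX_natCast_div_three ha]

theorem le_peanoX_of_mem_Icc (ha : a ≤ 3) (ht : t ∈ Icc ((a : ℝ) / 3) 1) :
    a / 3 ≤ peanoX t := by
  obtain ⟨k, hk, hkt⟩ := exists_mem_column ⟨le_trans (by positivity) ht.1, ht.2⟩
  rcases Nat.lt_or_ge k a with hka | hak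
  · have : (k : ℝ) + 1 ≤ a := by exact_mod_cast hka
    rw [show t = a / 3 by linarith [hkt.2, ht.1], peanoX_natCast_div_three ha]
  · have : (a : ℝ) ≤ k := by exact_mod_cast hak
    linarith [(peanoX_mem_column hk hkt).1]

theorem peanoX_sub_le_third {u v : ℝ} (hu : 0 ≤ u) (huv : u ≤ v) (hv : v ≤ 1) :
    peanoX u - peanoX v ≤ 1 / 3 := by
  obtain ⟨a, ha, hua⟩ := exists_mem_column ⟨hu, huv.trans hv⟩
  linarith [(peanoX_mem_column ha hua).2, le_peanoX_of_mem_Icc ha.le ⟨hua.1.trans huv, hv⟩]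

end Columns

/-- The cell of level `m` with number `i`, the set of times in `[0,1]` whose first `2 m` ternary
digits are those of `i / 9 ^ m`. Both endpoints are included, so that neighbouring cells share
one point. -/
def peanoCell (m i : ℕ) : Set ℝ := Icc ((i : ℝ) / 9 ^ m) ((i + 1) / 9 ^ m)

section Cells

variable {m i : ℕ}

theorem mem_peanoCell_iff {t : ℝ} : t ∈ peanoCell m i ↔ 9 ^ m * t - i ∈ Icc (0 : ℝ) 1 := by
  have h9 : (0 : ℝ) < 9 ^ m := by positivity
  rw [peanoCell, mem_Icc, mem_Icc, div_le_iff₀ h9, le_div_iff₀ h9]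
  constructor <;> rintro ⟨h1, h2⟩ <;> constructor <;> linarith

theorem peanoCell_subset (hi : i < 9 ^ m) : peanoCell m i ⊆ Icc 0 1 := by
  intro t ht
  refine ⟨le_trans (by positivity) ht.1, ht.2.trans ?_⟩
  rw [div_le_one (by positivity)]
  exact_mod_cast hi

theorem exists_mem_peanoCell (m : ℕ) {t : ℝ} (ht : t ∈ Icc (0 : ℝ) 1) :
    ∃ i < 9 ^ m, t ∈ peanoCell m i := by
  obtain ⟨i, hi, h⟩ := exists_nat_add_mem_Icc (M := 9 ^ m) (by positivity) (w := 9 ^ m * t)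
    ⟨mul_nonneg (by positivity) ht.1, by
      push_cast; exact mul_le_of_le_one_right (by positivity) ht.2⟩
  exact ⟨i, hi, mem_peanoCell_iff.2 h⟩

theorem exists_peanoX_cell_eq (hi : i < 9 ^ m) : ∃ A k : ℝ, |k| = (1 / 3) ^ m ∧
    ∀ s ∈ Icc (0 : ℝ) 1, peanoX ((i + s) / 9 ^ m) = A + k * peanoX s := by
  induction m generalizing i with
  | zero =>
    obtain rfl : i = 0 := by simpa using hi
    exact ⟨0, 1, by simp, fun s _ => by simp⟩
  | succ m ih =>
    obtain ⟨A, k, hk, h⟩ := ih (i := i / 9) (by rw [pow_succ] at hi; omega)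
    set a := i % 9 / 3
    set b := i % 3
    have ha : a < 3 := by omega
    have hb : b < 3 := by omega
    have subcell_eq : ∀ s ∈ Icc (0 : ℝ) 1, peanoX ((i + s) / 9 ^ (m + 1)) =
        A + k * ((a + if b = 1 then 1 - peanoX s else peanoX s) / 3) := by
      intro s hs
      have ha' : (a : ℝ) ≤ 2 := by exact_mod_cast Nat.le_of_lt_succ ha
      have hb' : (b : ℝ) ≤ 2 := by exact_mod_cast Nat.le_of_lt_succ hb
      have hi' : (i : ℝ) = 9 * (i / 9 : ℕ) + (3 * a + b) := by
        exact_mod_cast (show i = 9 * (i / 9) + (3 * a + b) by omega)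
      obtain ⟨hs0, hs1⟩ := hs
      rw [← peanoX_subcell ha hb ⟨hs0, hs1⟩, ← h _ ⟨by positivity, by linarith⟩]
      congr 1
      rw [hi', pow_succ]
      field_simp
      ring
    by_cases hb1 : b = 1
    · refine ⟨A + k * ((a + 1) / 3), -(k / 3), by rw [abs_neg, abs_div, hk]; norm_num; ring,
        fun s hs => ?_⟩
      rw [subcell_eq s hs, if_pos hb1]; ring
    · refine ⟨A + k * (a / 3), k / 3, by rw [abs_div, hk]; norm_num; ring, fun s hs => ?_⟩
      rw [subcell_eq s hs, if_neg hb1]; ring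

theorem exists_peanoX_eq_of_mem_cell (hi : i < 9 ^ m) : ∃ A k : ℝ, |k| = (1 / 3) ^ m ∧
    ∀ t ∈ peanoCell m i, peanoX t = A + k * peanoX (9 ^ m * t - i) := by
  obtain ⟨A, k, hk, h⟩ := exists_peanoX_cell_eq hi
  refine ⟨A, k, hk, fun t ht => ?_⟩
  rw [← h _ (mem_peanoCell_iff.1 ht)]
  congr 1
  field_simp
  ring

theorem abs_peanoX_sub_le_of_mem_cell (hi : i < 9 ^ m) {u v : ℝ} (hu : u ∈ peanoCell m i)
    (hv : v ∈ peanoCell m i) : |peanoX u - peanoX v| ≤ (1 / 3) ^ m := by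
  obtain ⟨A, k, hk, h⟩ := exists_peanoX_eq_of_mem_cell hi
  obtain ⟨hp0, hp1⟩ := peanoX_mem_Icc (9 ^ m * u - i)
  obtain ⟨hq0, hq1⟩ := peanoX_mem_Icc (9 ^ m * v - i)
  rw [h u hu, h v hv, add_sub_add_left_eq_sub, ← mul_sub, abs_mul, hk]
  exact mul_le_of_le_one_right (by positivity) (abs_le.2 ⟨by linarith, by linarith⟩)

theorem abs_peanoX_sub_le_of_close {u v : ℝ} (hu : 0 ≤ u) (huv : u ≤ v) (hv : v ≤ 1)
    (hc : v ≤ u + 1 / 9 ^ m) : |peanoX u - peanoX v| ≤ 2 * (1 / 3) ^ m := by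
  have h3 : (0 : ℝ) < (1 / 3) ^ m := by positivity
  have h9 : (0 : ℝ) < 9 ^ m := by positivity
  obtain ⟨i, hi, hui⟩ := exists_mem_peanoCell m ⟨hu, huv.trans hv⟩
  rcases le_or_gt v ((i + 1) / 9 ^ m) with hvi | hvi
  · linarith [abs_peanoX_sub_le_of_mem_cell hi hui ⟨hui.1.trans huv, hvi⟩]
  have hi1 : i + 1 < 9 ^ m := by
    have := hvi.trans_le hv
    rw [div_lt_one h9] at this
    exact_mod_cast this
  have joint_mem : ((i : ℝ) + 1) / 9 ^ m ∈ peanoCell m i := ⟨by gcongr; linarith, le_rfl⟩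
  have joint_mem_succ : ((i : ℝ) + 1) / 9 ^ m ∈ peanoCell m (i + 1) := by
    rw [peanoCell]
    push_cast
    exact ⟨le_rfl, by gcongr; linarith⟩
  have hv_mem : v ∈ peanoCell m (i + 1) := by
    rw [peanoCell]
    push_cast
    exact ⟨hvi.le, by rw [add_div _ 1]; linarith [hui.2]⟩
  linarith [abs_sub_le (peanoX u) (peanoX ((i + 1) / 9 ^ m)) (peanoX v),
    abs_peanoX_sub_le_of_mem_cell hi hui joint_mem,
    abs_peanoX_sub_le_of_mem_cell hi1 joint_mem_succ hv_mem]

end Cells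

theorem continuousOn_peanoX : ContinuousOn peanoX (Icc 0 1) := by
  rw [Metric.continuousOn_iff]
  intro v hv ε hε
  obtain ⟨m, hm⟩ := exists_pow_lt_of_lt_one (half_pos hε) (show (1 / 3 : ℝ) < 1 by norm_num)
  refine ⟨1 / 9 ^ m, by positivity, fun u hu huv => ?_⟩
  rw [Real.dist_eq, abs_lt] at huv
  rw [Real.dist_eq]
  rcases le_total u v with h | h
  · linarith [abs_peanoX_sub_le_of_close (m := m) hu.1 h hv.2 (by linarith)]
  · rw [abs_sub_comm]
    linarith [abs_peanoX_sub_le_of_close (m := m) hv.1 h hu.2 (by linarith)]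

/-! ### Crossings of a continuous function -/

/-- `DownChain f lo hi b a n`: there are times `a ≤ u₁ ≤ v₁ ≤ … ≤ uₙ ≤ vₙ ≤ b` with
`hi ≤ f uᵢ` and `f vᵢ < lo`. For continuous `f` and `lo < hi` the number of downcrossings is the
largest such `n`. The end `b` is a parameter of the inductive family and the start `a` an index, so
that chains grow at their beginning. -/
inductive DownChain (f : ℝ → ℝ) (lo hi b : ℝ) : ℝ → ℕ → Prop
  | zero {a : ℝ} : a ≤ b → DownChain f lo hi b a 0
  | succ {a u v : ℝ} {n : ℕ} : a ≤ u → u ≤ v → hi ≤ f u → f v < lo →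
      DownChain f lo hi b v n → DownChain f lo hi b a (n + 1)

namespace DownChain

variable {f : ℝ → ℝ} {lo hi a b s : ℝ} {n m : ℕ}

theorem le (h : DownChain f lo hi b a n) : a ≤ b := by
  induction h with
  | zero h => exact h
  | succ hau huv _ _ _ ih => exact hau.trans (huv.trans ih)

theorem mono_left (h : DownChain f lo hi b s n) (has : a ≤ s) : DownChain f lo hi b a n := by
  cases h with
  | zero h => exact .zero (has.trans h)
  | succ hsu huv hu hv h => exact .succ (has.trans hsu) huv hu hv h

theorem mono_right (h : DownChain f lo hi s a n) (hsb : s ≤ b) : DownChain f lo hi b a n := by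
  induction h with
  | zero h => exact .zero (h.trans hsb)
  | succ hau huv hu hv _ ih => exact .succ hau huv hu hv ih

theorem append (h : DownChain f lo hi s a n) (h' : DownChain f lo hi b s m) :
    DownChain f lo hi b a (m + n) := by
  induction h with
  | zero h => exact h'.mono_left h
  | succ hau huv hu hv _ ih => exact .succ hau huv hu hv ih

theorem pred (h : DownChain f lo hi b a (n + 1)) : DownChain f lo hi b a n := by
  cases h with
  | succ hau huv _ _ h => exact h.mono_left (hau.trans huv)

theorem of_le (h : DownChain f lo hi b a n) (hmn : m ≤ n) : DownChain f lo hi b a m := by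
  induction n, hmn using Nat.le_induction with
  | base => exact h
  | succ k _ ih => exact ih h.pred

theorem map {g : ℝ → ℝ} {lo' hi' b' : ℝ} {φ : ℝ → ℝ} (h : DownChain f lo hi b a n)
    (hφ : MonotoneOn φ (Icc a b)) (hφb : φ b ≤ b')
    (hhi : ∀ u ∈ Icc a b, hi ≤ f u → hi' ≤ g (φ u))
    (hlo : ∀ u ∈ Icc a b, f u < lo → g (φ u) < lo') : DownChain g lo' hi' b' (φ a) n := by
  induction h with
  | zero h => exact .zero ((hφ ⟨le_rfl, h⟩ ⟨h, le_rfl⟩ h).trans hφb)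
  | @succ a u v n hau huv hu hv h ih =>
    have hvb := h.le
    have hu_mem : u ∈ Icc a b := ⟨hau, huv.trans hvb⟩
    have hv_mem : v ∈ Icc a b := ⟨hau.trans huv, hvb⟩
    have hsub : Icc v b ⊆ Icc a b := Icc_subset_Icc_left hv_mem.1
    exact .succ (hφ ⟨le_rfl, hau.trans hu_mem.2⟩ hu_mem hau) (hφ hu_mem hv_mem huv)
      (hhi u hu_mem hu) (hlo v hv_mem hv)
      (ih (hφ.mono hsub) (fun p hp => hhi p (hsub hp)) fun p hp => hlo p (hsub hp))

theorem split (h : DownChain f lo hi b a n) (has : a ≤ s) (hsb : s ≤ b) :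
    ∃ k l, DownChain f lo hi s a k ∧ DownChain f lo hi b s l ∧ n ≤ k + l + 1 ∧
      ((∀ u ∈ Icc a s, ∀ v ∈ Icc s b, hi ≤ f u → f v < lo → hi ≤ f s ∨ f s < lo) →
        n ≤ k + l) := by
  induction h with
  | zero => exact ⟨0, 0, .zero has, .zero hsb, by simp, by simp⟩
  | @succ a u v n hau huv hu hv h ih =>
    rcases le_or_gt v s with hvs | hsv
    · obtain ⟨k, l, hk, hl, hn, hn'⟩ := ih hvs
      refine ⟨k + 1, l, .succ hau huv hu hv hk, hl, by omega, fun H => ?_⟩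
      have := hn' fun p hp => H p ⟨(hau.trans huv).trans hp.1, hp.2⟩
      omega
    rcases le_or_gt s u with hsu | hus
    · exact ⟨0, n + 1, .zero has, .succ hsu huv hu hv h, by omega, fun _ => by omega⟩
    by_cases hhi : hi ≤ f s
    · exact ⟨0, n + 1, .zero has, .succ le_rfl hsv.le hhi hv h, by omega, fun _ => by omega⟩
    by_cases hlo : f s < lo
    · exact ⟨1, n, .succ hau hus.le hu hlo (.zero le_rfl), h.mono_left hsv.le, by omega,
        fun _ => by omega⟩
    · exact ⟨0, n, .zero has, h.mono_left hsv.le, by omega, fun H =>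
        absurd (H u ⟨hau, hus.le⟩ v ⟨hsv.le, h.le⟩ hu hv) (not_or.2 ⟨hhi, hlo⟩)⟩

theorem mul_le {δ : ℝ} (h : DownChain f lo hi b a n)
    (hδ : ∀ u ∈ Icc a b, ∀ v ∈ Icc a b, hi ≤ f u → f v < lo → δ ≤ |u - v|) :
    n * δ ≤ b - a := by
  induction h with
  | zero h => simpa using h
  | @succ a u v n hau huv hu hv h ih =>
    have hav := hau.trans huv
    have hvb := h.le
    have tail_le := ih fun p hp q hq => hδ p ⟨hav.trans hp.1, hp.2⟩ q ⟨hav.trans hq.1, hq.2⟩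
    have step_le := hδ u ⟨hau, huv.trans hvb⟩ v ⟨hav, hvb⟩ hu hv
    rw [abs_of_nonpos (by linarith)] at step_le
    push_cast
    linarith

theorem exists_forall_lower {z c : ℝ} (h : DownChain f (z - c / 2) (z + c / 2) b a n) :
    ∃ ε > 0, ∀ y, z - ε < y → y ≤ z → DownChain f (y - c / 2) (y + c / 2) b a n := by
  induction h with
  | zero h => exact ⟨1, one_pos, fun y _ _ => .zero h⟩
  | @succ a u v n hau huv hu hv _ ih =>
    obtain ⟨ε, hε, H⟩ := ih
    refine ⟨min ε (z - c / 2 - f v), lt_min hε (by linarith), fun y hy hyz => ?_⟩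
    have := min_le_left ε (z - c / 2 - f v)
    have := min_le_right ε (z - c / 2 - f v)
    exact .succ hau huv (by linarith) (by linarith) (H y (by linarith) hyz)

end DownChain

section HittingTimes

variable {f : ℝ → ℝ} {z c a b s : ℝ}

theorem sInf_image_coe_eReal {S : Set ℝ} (hne : S.Nonempty) (hbd : BddBelow S) :
    sInf ((fun u : ℝ => (u : EReal)) '' S) = ((sInf S : ℝ) : EReal) :=
  (EReal.coe_strictMono.monotone.map_csInf_of_continuousAt
    continuous_coe_real_ereal.continuousAt hne hbd).symm

theorem nonempty_of_sInf_image_coe_le {S : Set ℝ}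
    (h : sInf ((fun u : ℝ => (u : EReal)) '' S) ≤ (b : EReal)) : S.Nonempty := by
  by_contra hS
  simp [not_nonempty_iff_eq_empty.1 hS] at h

theorem le_hitAbove (x : EReal) : x ≤ hitAbove f z c b x := by
  refine le_sInf ?_
  rintro _ ⟨u, hu, rfl⟩
  exact hu.1

theorem le_hitBelow (x : EReal) : x ≤ hitBelow f z c b x := by
  refine le_sInf ?_
  rintro _ ⟨u, hu, rfl⟩
  exact hu.1

theorem exists_eq_hitAbove (hf : ContinuousOn f (Icc a b))
    (h : hitAbove f z c b a ≤ (b : EReal)) :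
    ∃ τ ∈ Icc a b, hitAbove f z c b a = (τ : EReal) ∧ z + c / 2 ≤ f τ := by
  have set_eq : {u : ℝ | (a : EReal) ≤ u ∧ u ≤ b ∧ z + c / 2 ≤ f u} =
      Icc a b ∩ f ⁻¹' Ici (z + c / 2) := by
    ext u
    simp [and_assoc]
  have closed : IsClosed (Icc a b ∩ f ⁻¹' Ici (z + c / 2)) :=
    hf.preimage_isClosed_of_isClosed isClosed_Icc isClosed_Ici
  have bdd : BddBelow (Icc a b ∩ f ⁻¹' Ici (z + c / 2)) := ⟨a, fun u hu => hu.1.1⟩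
  rw [hitAbove, set_eq] at h ⊢
  have nonempty := nonempty_of_sInf_image_coe_le h
  obtain ⟨mem_Icc, le_f⟩ := closed.csInf_mem nonempty bdd
  exact ⟨_, mem_Icc, sInf_image_coe_eReal nonempty bdd, le_f⟩

theorem exists_eq_hitBelow (hf : ContinuousOn f (Icc a b))
    (h : hitBelow f z c b a ≤ (b : EReal)) :
    ∃ σ ∈ Icc a b, hitBelow f z c b a = (σ : EReal) ∧ f σ ≤ z - c / 2 ∧
      ∀ ε > 0, ∃ v ∈ Icc σ b, v < σ + ε ∧ f v < z - c / 2 := by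
  have set_eq : {u : ℝ | (a : EReal) ≤ u ∧ u ≤ b ∧ f u < z - c / 2} =
      Icc a b ∩ f ⁻¹' Iio (z - c / 2) := by
    ext u
    simp [and_assoc]
  have bdd : BddBelow (Icc a b ∩ f ⁻¹' Iio (z - c / 2)) := ⟨a, fun u hu => hu.1.1⟩
  have closed : IsClosed (Icc a b ∩ f ⁻¹' Iic (z - c / 2)) :=
    hf.preimage_isClosed_of_isClosed isClosed_Icc isClosed_Iic
  rw [hitBelow, set_eq] at h ⊢
  have nonempty := nonempty_of_sInf_image_coe_le h
  obtain ⟨mem_Icc, f_le⟩ := closed.closure_subset_iff.2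
    (inter_subset_inter_right _ fun u (hu : f u < z - c / 2) => hu.le)
    (csInf_mem_closure nonempty bdd)
  refine ⟨_, mem_Icc, sInf_image_coe_eReal nonempty bdd, f_le, fun ε hε => ?_⟩
  obtain ⟨v, hv, hvε⟩ := exists_lt_of_csInf_lt nonempty (lt_add_of_pos_right _ hε)
  exact ⟨v, ⟨csInf_le bdd hv, hv.1.2⟩, hvε, hv.2⟩

theorem DownChain.downcrossingTime_add_le {k n : ℕ}
    (h : DownChain f (z - c / 2) (z + c / 2) b s n)
    (hk : downcrossingTime f z c a b k ≤ (s : EReal)) :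
    downcrossingTime f z c a b (n + k) ≤ (b : EReal) := by
  induction h generalizing k with
  | zero h => simpa using hk.trans (EReal.coe_le_coe_iff.2 h)
  | @succ s u v n hsu huv hu hv h ih =>
    have hitAbove_le : hitAbove f z c b (downcrossingTime f z c a b k) ≤ (u : EReal) :=
      sInf_le ⟨u, ⟨hk.trans (EReal.coe_le_coe_iff.2 hsu), huv.trans h.le, hu⟩, rfl⟩
    have time_succ_le : downcrossingTime f z c a b (k + 1) ≤ (v : EReal) :=
      sInf_le ⟨v, ⟨hitAbove_le.trans (EReal.coe_le_coe_iff.2 huv), h.le, hv⟩, rfl⟩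
    rw [show n + 1 + k = n + (k + 1) by ring]
    exact ih time_succ_le

/- The infimum defining `σ_n` need not be attained, so chains of length `n` are only found on
intervals ending slightly after `σ_n`. -/
theorem exists_downChain_near_downcrossingTime (hf : ContinuousOn f (Icc a b)) (hab : a ≤ b)
    (hc : 0 < c) {n : ℕ} (hn : downcrossingTime f z c a b n ≤ (b : EReal)) :
    ∃ σ ∈ Icc a b, downcrossingTime f z c a b n = (σ : EReal) ∧ (n = 0 ∨ f σ ≤ z - c / 2) ∧
      ∀ ε > 0, ∃ v ∈ Icc σ b, v < σ + ε ∧ DownChain f (z - c / 2) (z + c / 2) v a n := by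
  induction n with
  | zero =>
    exact ⟨a, ⟨le_rfl, hab⟩, rfl, Or.inl rfl, fun ε hε =>
      ⟨a, ⟨le_rfl, hab⟩, by linarith, .zero le_rfl⟩⟩
  | succ n ih =>
    rw [downcrossingTime] at hn ⊢
    obtain ⟨σ, hσ, hσ_eq, hσ_lo, hσ_chain⟩ := ih ((le_hitAbove _).trans ((le_hitBelow _).trans hn))
    rw [hσ_eq] at hn ⊢
    obtain ⟨τ, hτ, hτ_eq, hτ_hi⟩ := exists_eq_hitAbove
      (hf.mono (Icc_subset_Icc_left hσ.1)) ((le_hitBelow _).trans hn)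
    rw [hτ_eq] at hn ⊢
    have haτ : a ≤ τ := hσ.1.trans hτ.1
    obtain ⟨v₀, hv₀τ, chain⟩ : ∃ v ≤ τ, DownChain f (z - c / 2) (z + c / 2) v a n := by
      rcases hσ_lo with rfl | hσ_lo
      · exact ⟨a, haτ, .zero le_rfl⟩
      · have hστ : σ ≠ τ := fun h => by rw [← h] at hτ_hi; linarith
        obtain ⟨v, -, hv, chain⟩ := hσ_chain (τ - σ) (sub_pos.2 (lt_of_le_of_ne hτ.1 hστ))
        exact ⟨v, by linarith, chain⟩
    obtain ⟨σ', hσ', hσ'_eq, hσ'_lo, hσ'_near⟩ :=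
      exists_eq_hitBelow (hf.mono (Icc_subset_Icc_left haτ)) hn
    refine ⟨σ', ⟨haτ.trans hσ'.1, hσ'.2⟩, hσ'_eq, Or.inr hσ'_lo, fun ε hε => ?_⟩
    obtain ⟨v, hv, hvε, hv_lo⟩ := hσ'_near ε hε
    refine ⟨v, hv, hvε, ?_⟩
    rw [add_comm n 1]
    exact chain.append (.succ hv₀τ (hσ'.1.trans hv.1) hτ_hi hv_lo (.zero le_rfl))

theorem downcrossingTime_le_iff (hf : ContinuousOn f (Icc a b)) (hab : a ≤ b) (hc : 0 < c)
    (n : ℕ) : downcrossingTime f z c a b n ≤ (b : EReal) ↔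
      DownChain f (z - c / 2) (z + c / 2) b a n := by
  refine ⟨fun h => ?_, fun h => h.downcrossingTime_add_le (k := 0) le_rfl⟩
  obtain ⟨σ, _, _, _, h⟩ := exists_downChain_near_downcrossingTime hf hab hc h
  obtain ⟨v, hv, _, chain⟩ := h 1 one_pos
  exact chain.mono_right hv.2

theorem exists_downChain_bound (hf : ContinuousOn f (Icc a b)) (hc : 0 < c) :
    ∃ K : ℕ, ∀ z n, DownChain f (z - c / 2) (z + c / 2) b a n → n ≤ K := by
  obtain ⟨δ, hδ, h⟩ := Metric.uniformContinuousOn_iff.1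
    (isCompact_Icc.uniformContinuousOn_of_continuous hf) c hc
  refine ⟨⌈(b - a) / δ⌉₊, fun z n hn => ?_⟩
  have length_le := hn.mul_le (δ := δ) fun u hu v hv hi lo => by
    by_contra! hlt
    have := h u hu v hv hlt
    rw [Real.dist_eq] at this
    linarith [le_abs_self (f u - f v)]
  rw [← le_div_iff₀ hδ] at length_le
  exact_mod_cast length_le.trans (Nat.le_ceil _)

theorem le_downcrossings_iff (hf : ContinuousOn f (Icc a b)) (hab : a ≤ b) (hc : 0 < c) {n : ℕ} :
    n ≤ downcrossings f z c a b ↔ DownChain f (z - c / 2) (z + c / 2) b a n := by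
  obtain ⟨K, hK⟩ := exists_downChain_bound (f := f) (a := a) (b := b) hf hc
  have bdd : BddAbove {n | DownChain f (z - c / 2) (z + c / 2) b a n} := ⟨K, fun n => hK z n⟩
  simp only [downcrossings, downcrossingTime_le_iff hf hab hc]
  exact ⟨(Nat.sSup_mem (s := {n | DownChain f (z - c / 2) (z + c / 2) b a n})
    ⟨0, .zero hab⟩ bdd).of_le, fun h => le_csSup bdd h⟩

end HittingTimes

section Crossings

variable {f g : ℝ → ℝ} {z c a b s : ℝ}

theorem crossings_eq_add : crossings f z c a b =
    downcrossings (fun u => -f u) (-z) c a b + downcrossings f z c a b :=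
  rfl

theorem crossings_neg : crossings (fun u => -f u) (-z) c a b = crossings f z c a b := by
  simp only [crossings_eq_add, neg_neg, add_comm]

theorem downChain_downcrossings (hf : ContinuousOn f (Icc a b)) (hab : a ≤ b) (hc : 0 < c) :
    DownChain f (z - c / 2) (z + c / 2) b a (downcrossings f z c a b) :=
  (le_downcrossings_iff hf hab hc).1 le_rfl

theorem downcrossings_add_le (hf : ContinuousOn f (Icc a b)) (hs : s ∈ Icc a b) (hc : 0 < c) :
    downcrossings f z c a s + downcrossings f z c s b ≤ downcrossings f z c a b := by
  rw [le_downcrossings_iff hf (hs.1.trans hs.2) hc,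
    add_comm (downcrossings f z c a s)]
  exact (downChain_downcrossings (hf.mono (Icc_subset_Icc_right hs.2)) hs.1 hc).append
    (downChain_downcrossings (hf.mono (Icc_subset_Icc_left hs.1)) hs.2 hc)

theorem crossings_add_le (hf : ContinuousOn f (Icc a b)) (hs : s ∈ Icc a b) (hc : 0 < c) :
    crossings f z c a s + crossings f z c s b ≤ crossings f z c a b := by
  rw [crossings_eq_add, crossings_eq_add, crossings_eq_add, add_add_add_comm]
  exact add_le_add (downcrossings_add_le hf.neg hs hc) (downcrossings_add_le hf hs hc)

theorem downcrossings_le_add_one (hf : ContinuousOn f (Icc a b)) (hs : s ∈ Icc a b)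
    (hc : 0 < c) :
    downcrossings f z c a b ≤ downcrossings f z c a s + downcrossings f z c s b + 1 := by
  obtain ⟨k, l, hk, hl, hn, -⟩ :=
    (downChain_downcrossings (z := z) hf (hs.1.trans hs.2) hc).split hs.1 hs.2
  have := (le_downcrossings_iff (hf.mono (Icc_subset_Icc_right hs.2)) hs.1 hc).2 hk
  have := (le_downcrossings_iff (hf.mono (Icc_subset_Icc_left hs.1)) hs.2 hc).2 hl
  omega

theorem downcrossings_le_add (hf : ContinuousOn f (Icc a b)) (hs : s ∈ Icc a b) (hc : 0 < c)
    (H : ∀ u ∈ Icc a s, ∀ v ∈ Icc s b, z + c / 2 ≤ f u → f v < z - c / 2 →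
      z + c / 2 ≤ f s ∨ f s < z - c / 2) :
    downcrossings f z c a b ≤ downcrossings f z c a s + downcrossings f z c s b := by
  obtain ⟨k, l, hk, hl, -, hn⟩ :=
    (downChain_downcrossings (z := z) hf (hs.1.trans hs.2) hc).split hs.1 hs.2
  have := (le_downcrossings_iff (hf.mono (Icc_subset_Icc_right hs.2)) hs.1 hc).2 hk
  have := (le_downcrossings_iff (hf.mono (Icc_subset_Icc_left hs.1)) hs.2 hc).2 hl
  have := hn H
  omega

theorem downcrossings_le_add_of_isMaxOn_left (hf : ContinuousOn f (Icc a b)) (hs : s ∈ Icc a b)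
    (hc : 0 < c) (hmax : IsMaxOn f (Icc a s) s) :
    downcrossings f z c a b ≤ downcrossings f z c a s + downcrossings f z c s b :=
  downcrossings_le_add hf hs hc fun _ hu _ _ hi _ => Or.inl (hi.trans (hmax hu))

theorem downcrossings_le_add_of_isMinOn_right (hf : ContinuousOn f (Icc a b)) (hs : s ∈ Icc a b)
    (hc : 0 < c) (hmin : IsMinOn f (Icc s b) s) :
    downcrossings f z c a b ≤ downcrossings f z c a s + downcrossings f z c s b :=
  downcrossings_le_add hf hs hc fun _ _ _ hv _ lo => Or.inr ((hmin hv).trans_lt lo)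

theorem downcrossings_le_add_indicator (hf : ContinuousOn f (Icc a b)) (hs : s ∈ Icc a b)
    (hc : 0 < c) :
    (downcrossings f z c a b : ℝ) ≤ downcrossings f z c a s + downcrossings f z c s b +
      (Icc (f s - c / 2) (f s + c / 2)).indicator 1 z := by
  by_cases hz : z ∈ Icc (f s - c / 2) (f s + c / 2)
  · rw [indicator_of_mem hz, Pi.one_apply]
    exact_mod_cast downcrossings_le_add_one hf hs hc
  · rw [indicator_of_notMem hz, add_zero]
    refine mod_cast downcrossings_le_add hf hs hc fun _ _ _ _ _ _ => ?_
    by_contra! h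
    exact hz ⟨by linarith [h.1], by linarith [h.2]⟩

theorem upcrossings_le_add_indicator (hf : ContinuousOn f (Icc a b)) (hs : s ∈ Icc a b)
    (hc : 0 < c) :
    (downcrossings (fun u => -f u) (-z) c a b : ℝ) ≤ downcrossings (fun u => -f u) (-z) c a s +
      downcrossings (fun u => -f u) (-z) c s b +
        (Icc (f s - c / 2) (f s + c / 2)).indicator 1 z := by
  have band_neg : (Icc (-f s - c / 2) (-f s + c / 2)).indicator (1 : ℝ → ℝ) (-z) =
      (Icc (f s - c / 2) (f s + c / 2)).indicator 1 z := by
    refine indicator_eq_indicator ?_ rfl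
    rw [mem_Icc, mem_Icc]
    constructor <;> rintro ⟨h, h'⟩ <;> constructor <;> linarith
  rw [← band_neg]
  exact downcrossings_le_add_indicator hf.neg hs hc

theorem crossings_le_add_indicator (hf : ContinuousOn f (Icc a b)) (hs : s ∈ Icc a b)
    (hc : 0 < c) :
    (crossings f z c a b : ℝ) ≤ crossings f z c a s + crossings f z c s b +
      2 * (Icc (f s - c / 2) (f s + c / 2)).indicator 1 z := by
  simp only [crossings_eq_add]
  push_cast
  linarith [downcrossings_le_add_indicator (z := z) hf hs hc,
    upcrossings_le_add_indicator (z := z) hf hs hc]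

theorem crossings_le_add_indicator_of_isMaxOn_left (hf : ContinuousOn f (Icc a b))
    (hs : s ∈ Icc a b) (hc : 0 < c) (hmax : IsMaxOn f (Icc a s) s) :
    (crossings f z c a b : ℝ) ≤ crossings f z c a s + crossings f z c s b +
      (Icc (f s - c / 2) (f s + c / 2)).indicator 1 z := by
  have down_le : (downcrossings f z c a b : ℝ) ≤
      downcrossings f z c a s + downcrossings f z c s b :=
    mod_cast downcrossings_le_add_of_isMaxOn_left hf hs hc hmax
  simp only [crossings_eq_add]
  push_cast
  linarith [upcrossings_le_add_indicator (z := z) hf hs hc]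

theorem crossings_le_add_of_isMaxOn (hf : ContinuousOn f (Icc a b)) (hs : s ∈ Icc a b)
    (hc : 0 < c) (hmax : IsMaxOn f (Icc a b) s) :
    crossings f z c a b ≤ crossings f z c a s + crossings f z c s b := by
  rw [crossings_eq_add, crossings_eq_add, crossings_eq_add, add_add_add_comm]
  exact add_le_add
    (downcrossings_le_add_of_isMinOn_right hf.neg hs hc
      (hmax.on_subset (Icc_subset_Icc_left hs.1)).neg)
    (downcrossings_le_add_of_isMaxOn_left hf hs hc (hmax.on_subset (Icc_subset_Icc_right hs.2)))

theorem crossings_le_add_of_isMinOn (hf : ContinuousOn f (Icc a b)) (hs : s ∈ Icc a b)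
    (hc : 0 < c) (hmin : IsMinOn f (Icc a b) s) :
    crossings f z c a b ≤ crossings f z c a s + crossings f z c s b := by
  simpa only [Pi.neg_def, crossings_neg] using
    crossings_le_add_of_isMaxOn (z := -z) hf.neg hs hc hmin.neg

theorem exists_of_crossings_ne_zero (hf : ContinuousOn f (Icc a b)) (hab : a ≤ b) (hc : 0 < c)
    (h : crossings f z c a b ≠ 0) :
    ∃ u ∈ Icc a b, ∃ v ∈ Icc a b, f u ≤ z - c / 2 ∧ z + c / 2 ≤ f v := by
  rcases Nat.add_pos_iff_pos_or_pos.1 (Nat.pos_of_ne_zero h) with h | h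
  · cases (le_downcrossings_iff hf.neg hab hc).1 h with
    | @succ _ u v _ hau huv hu hv hrest =>
      exact ⟨u, ⟨hau, huv.trans hrest.le⟩, v, ⟨hau.trans huv, hrest.le⟩,
        by linarith [show -z + c / 2 ≤ -f u from hu], by linarith [show -f v < -z - c / 2 from hv]⟩
  · cases (le_downcrossings_iff hf hab hc).1 h with
    | @succ _ u v _ hau huv hu hv hrest =>
      exact ⟨v, ⟨hau.trans huv, hrest.le⟩, u, ⟨hau, huv.trans hrest.le⟩, hv.le, hu⟩

theorem mem_image_of_crossings_ne_zero (hf : ContinuousOn f (Icc a b)) (hab : a ≤ b)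
    (hc : 0 < c) (h : crossings f z c a b ≠ 0) : z ∈ f '' Icc a b := by
  obtain ⟨u, hu, v, hv, hlo, hhi⟩ := exists_of_crossings_ne_zero hf hab hc h
  exact (isPreconnected_Icc.image f hf).ordConnected.out (mem_image_of_mem f hu)
    (mem_image_of_mem f hv) ⟨by linarith, by linarith⟩

section Comparison

variable {φ : ℝ → ℝ} {a' b' A k : ℝ}

theorem downcrossings_le_of_affine (hf : ContinuousOn f (Icc a b)) (hab : a ≤ b) (hc : 0 < c)
    (hg : ContinuousOn g (Icc a' b')) (hφ : MonotoneOn φ (Icc a b)) (hφa : a' ≤ φ a)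
    (hφb : φ b ≤ b') (hk : 0 < k) (hfg : ∀ u ∈ Icc a b, f u = A + k * g (φ u)) :
    downcrossings f z c a b ≤ downcrossings g ((z - A) / k) (c / k) a' b' := by
  have hab' : a' ≤ b' := hφa.trans ((hφ ⟨le_rfl, hab⟩ ⟨hab, le_rfl⟩ hab).trans hφb)
  rw [le_downcrossings_iff hg hab' (by positivity)]
  refine ((downChain_downcrossings hf hab hc).map hφ hφb (fun u hu h => ?_)
    fun u hu h => ?_).mono_left hφa
  · rw [hfg u hu] at h
    rw [show (z - A) / k + c / k / 2 = (z + c / 2 - A) / k by ring, div_le_iff₀ hk]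
    linarith
  · rw [hfg u hu] at h
    rw [show (z - A) / k - c / k / 2 = (z - c / 2 - A) / k by ring, lt_div_iff₀ hk]
    linarith

theorem crossings_le_of_affine_pos (hf : ContinuousOn f (Icc a b)) (hab : a ≤ b) (hc : 0 < c)
    (hg : ContinuousOn g (Icc a' b')) (hφ : MonotoneOn φ (Icc a b)) (hφa : a' ≤ φ a)
    (hφb : φ b ≤ b') (hk : 0 < k) (hfg : ∀ u ∈ Icc a b, f u = A + k * g (φ u)) :
    crossings f z c a b ≤ crossings g ((z - A) / k) (c / k) a' b' := by
  rw [crossings_eq_add, crossings_eq_add, show -((z - A) / k) = (-z - -A) / k by ring]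
  exact add_le_add
    (downcrossings_le_of_affine hf.neg hab hc hg.neg hφ hφa hφb hk fun u hu => by
      simp only [hfg u hu]; ring)
    (downcrossings_le_of_affine hf hab hc hg hφ hφa hφb hk hfg)

theorem crossings_le_of_affine (hf : ContinuousOn f (Icc a b)) (hab : a ≤ b) (hc : 0 < c)
    (hg : ContinuousOn g (Icc a' b')) (hφ : MonotoneOn φ (Icc a b)) (hφa : a' ≤ φ a)
    (hφb : φ b ≤ b') (hk : k ≠ 0) (hfg : ∀ u ∈ Icc a b, f u = A + k * g (φ u)) :
    crossings f z c a b ≤ crossings g ((z - A) / k) (c / |k|) a' b' := by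
  rcases hk.lt_or_gt with hk | hk
  · rw [abs_of_neg hk, ← crossings_neg (f := g), ← div_neg]
    exact crossings_le_of_affine_pos hf hab hc hg.neg hφ hφa hφb (neg_pos.2 hk) fun u hu => by
      simp only [hfg u hu]; ring
  · rw [abs_of_pos hk]
    exact crossings_le_of_affine_pos hf hab hc hg hφ hφa hφb hk hfg

end Comparison

theorem measurable_downcrossings (hf : ContinuousOn f (Icc a b)) (hab : a ≤ b) (hc : 0 < c) :
    Measurable fun z => downcrossings f z c a b := by
  have measurable_comp_neg : Measurable fun y => downcrossings f (-y) c a b := by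
    refine measurable_of_Ici fun n => MeasurableSet.of_mem_nhdsGT fun y hy => ?_
    obtain ⟨ε, hε, H⟩ := ((le_downcrossings_iff hf hab hc).1 hy).exists_forall_lower
    filter_upwards [Ioo_mem_nhdsGT (show y < y + ε by linarith)] with w hw
    exact (le_downcrossings_iff hf hab hc).2 (H _ (by linarith [hw.2]) (by linarith [hw.1]))
  simpa [Function.comp_def] using measurable_comp_neg.comp measurable_neg

theorem measurable_crossings (hf : ContinuousOn f (Icc a b)) (hab : a ≤ b) (hc : 0 < c) :
    Measurable fun z => crossings f z c a b :=
  ((measurable_downcrossings hf.neg hab hc).comp measurable_neg).add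
    (measurable_downcrossings hf hab hc)

theorem exists_crossings_bound (hf : ContinuousOn f (Icc a b)) (hab : a ≤ b) (hc : 0 < c) :
    ∃ K : ℕ, ∀ z, crossings f z c a b ≤ K := by
  obtain ⟨K, hK⟩ := exists_downChain_bound hf hc
  obtain ⟨K', hK'⟩ := exists_downChain_bound hf.neg hc
  exact ⟨K' + K, fun z => add_le_add (hK' _ _ (downChain_downcrossings hf.neg hab hc))
    (hK _ _ (downChain_downcrossings hf hab hc))⟩

theorem integrable_crossings_mul (hf : ContinuousOn f (Icc a b)) (hab : a ≤ b) (hc : 0 < c)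
    (hg : Continuous g) : Integrable (fun z => (crossings f z c a b : ℝ) * g z) volume := by
  obtain ⟨K, hK⟩ := exists_crossings_bound hf hab hc
  have compact_image := isCompact_Icc.image_of_continuousOn hf
  have support_subset :
      Function.support (fun z => (crossings f z c a b : ℝ) * g z) ⊆ f '' Icc a b :=
    fun z hz => mem_image_of_crossings_ne_zero hf hab hc fun h => hz (by simp [h])
  rw [← integrableOn_iff_integrable_of_support_subset support_subset]
  refine (hg.continuousOn.integrableOn_compact compact_image).bdd_mul (c := K)
    (measurable_from_nat.comp (measurable_crossings hf hab hc)).aestronglyMeasurable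
    (ae_of_all _ fun z => ?_)
  rw [Real.norm_natCast]
  exact_mod_cast hK z

theorem integrable_crossings (hf : ContinuousOn f (Icc a b)) (hab : a ≤ b) (hc : 0 < c) :
    Integrable (fun z => (crossings f z c a b : ℝ)) volume := by
  simpa using integrable_crossings_mul hf hab hc (continuous_const (y := (1 : ℝ)))

end Crossings

/-! ### The mean number of crossings -/

/-- The mean number of crossings of a band of width `c`, the band ranging over all levels. It is the
analogue for truncated variation of the Banach indicatrix integral. -/
noncomputable def totalCrossings (f : ℝ → ℝ) (c a b : ℝ) : ℝ := ∫ z, (crossings f z c a b : ℝ)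

section TotalCrossings

variable {f g : ℝ → ℝ} {c a b s B : ℝ}

theorem integrable_indicator_Icc_one (p q : ℝ) :
    Integrable ((Icc p q).indicator (1 : ℝ → ℝ)) volume :=
  (integrable_indicator_iff measurableSet_Icc).2 (integrableOn_const (by simp))

theorem integral_indicator_Icc_one {p q : ℝ} (hpq : p ≤ q) :
    ∫ z, (Icc p q).indicator (1 : ℝ → ℝ) z = q - p := by
  rw [integral_indicator_one measurableSet_Icc, Real.volume_real_Icc_of_le hpq]

theorem totalCrossings_nonneg : 0 ≤ totalCrossings f c a b :=
  integral_nonneg fun _ => Nat.cast_nonneg _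

theorem totalCrossings_add_le (hf : ContinuousOn f (Icc a b)) (hs : s ∈ Icc a b) (hc : 0 < c) :
    totalCrossings f c a s + totalCrossings f c s b ≤ totalCrossings f c a b := by
  have left := integrable_crossings (hf.mono (Icc_subset_Icc_right hs.2)) hs.1 hc
  have right := integrable_crossings (hf.mono (Icc_subset_Icc_left hs.1)) hs.2 hc
  rw [totalCrossings, totalCrossings, ← integral_add' left right]
  exact integral_mono (left.add right) (integrable_crossings hf (hs.1.trans hs.2) hc)
    fun z => by simpa using mod_cast crossings_add_le (z := z) hf hs hc

theorem totalCrossings_self (hc : 0 < c) : totalCrossings f c a a = 0 := by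
  have hf : ContinuousOn f (Icc a a) := by rw [Icc_self]; exact continuousOn_singleton f a
  have := totalCrossings_add_le hf ⟨le_rfl, le_rfl⟩ hc
  linarith [totalCrossings_nonneg (f := f) (c := c) (a := a) (b := a)]

theorem totalCrossings_le_add {h : ℝ → ℝ} (hf : ContinuousOn f (Icc a b)) (hs : s ∈ Icc a b)
    (hc : 0 < c) (hh : Integrable h volume)
    (hle : ∀ z, (crossings f z c a b : ℝ) ≤ crossings f z c a s + crossings f z c s b + h z) :
    totalCrossings f c a b ≤ totalCrossings f c a s + totalCrossings f c s b + ∫ z, h z := by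
  have left := integrable_crossings (hf.mono (Icc_subset_Icc_right hs.2)) hs.1 hc
  have right := integrable_crossings (hf.mono (Icc_subset_Icc_left hs.1)) hs.2 hc
  simp only [totalCrossings]
  rw [← integral_add' left right, ← integral_add' (left.add right) hh]
  exact integral_mono (integrable_crossings hf (hs.1.trans hs.2) hc) ((left.add right).add hh) hle

theorem totalCrossings_le_add_of_isMaxOn_left (hf : ContinuousOn f (Icc a b)) (hs : s ∈ Icc a b)
    (hc : 0 < c) (hmax : IsMaxOn f (Icc a s) s) :
    totalCrossings f c a b ≤ totalCrossings f c a s + totalCrossings f c s b + c := by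
  have h := totalCrossings_le_add hf hs hc (integrable_indicator_Icc_one _ _)
    fun z => crossings_le_add_indicator_of_isMaxOn_left (z := z) hf hs hc hmax
  rw [integral_indicator_Icc_one (by linarith)] at h
  linarith

theorem totalCrossings_le_add_of_isMaxOn (hf : ContinuousOn f (Icc a b)) (hs : s ∈ Icc a b)
    (hc : 0 < c) (hmax : IsMaxOn f (Icc a b) s) :
    totalCrossings f c a b ≤ totalCrossings f c a s + totalCrossings f c s b := by
  simpa using totalCrossings_le_add hf hs hc (integrable_zero ℝ ℝ volume) fun z => by
    simpa using mod_cast crossings_le_add_of_isMaxOn (z := z) hf hs hc hmax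

theorem totalCrossings_le_add_of_isMinOn (hf : ContinuousOn f (Icc a b)) (hs : s ∈ Icc a b)
    (hc : 0 < c) (hmin : IsMinOn f (Icc a b) s) :
    totalCrossings f c a b ≤ totalCrossings f c a s + totalCrossings f c s b := by
  simpa using totalCrossings_le_add hf hs hc (integrable_zero ℝ ℝ volume) fun z => by
    simpa using mod_cast crossings_le_add_of_isMinOn (z := z) hf hs hc hmin

theorem totalCrossings_le_of_affine {φ : ℝ → ℝ} {a' b' A k : ℝ} (hf : ContinuousOn f (Icc a b))
    (hab : a ≤ b) (hc : 0 < c) (hg : ContinuousOn g (Icc a' b')) (hφ : MonotoneOn φ (Icc a b))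
    (hφa : a' ≤ φ a) (hφb : φ b ≤ b') (hk : k ≠ 0) (hfg : ∀ u ∈ Icc a b, f u = A + k * g (φ u)) :
    totalCrossings f c a b ≤ |k| * totalCrossings g (c / |k|) a' b' := by
  have hab' : a' ≤ b' := hφa.trans ((hφ ⟨le_rfl, hab⟩ ⟨hab, le_rfl⟩ hab).trans hφb)
  have integrable_g : Integrable fun z => (crossings g (z / k) (c / |k|) a' b' : ℝ) :=
    (integrable_crossings hg hab' (div_pos hc (abs_pos.2 hk))).comp_div hk
  calc totalCrossings f c a b
      ≤ ∫ z, (crossings g ((z - A) / k) (c / |k|) a' b' : ℝ) :=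
        integral_mono (integrable_crossings hf hab hc) (integrable_g.comp_sub_right A) fun z =>
          Nat.cast_le.2 (crossings_le_of_affine hf hab hc hg hφ hφa hφb hk hfg)
    _ = ∫ z, (crossings g (z / k) (c / |k|) a' b' : ℝ) :=
        integral_sub_right_eq_self (fun z => (crossings g (z / k) (c / |k|) a' b' : ℝ)) A
    _ = |k| * totalCrossings g (c / |k|) a' b' := by
        rw [Measure.integral_comp_div (fun z => (crossings g z (c / |k|) a' b' : ℝ)), smul_eq_mul,
          totalCrossings]

theorem abs_integral_crossings_mul_sub_add_le (hf : ContinuousOn f (Icc a b)) (hs : s ∈ Icc a b)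
    (hc : 0 < c) (hg : Continuous g) (hB : ∀ u ∈ Icc a b, |g (f u)| ≤ B) :
    |(∫ z, (crossings f z c a b : ℝ) * g z) - ((∫ z, (crossings f z c a s : ℝ) * g z) +
      ∫ z, (crossings f z c s b : ℝ) * g z)| ≤ 2 * B * c := by
  have left := integrable_crossings_mul (hf.mono (Icc_subset_Icc_right hs.2)) hs.1 hc hg
  have right := integrable_crossings_mul (hf.mono (Icc_subset_Icc_left hs.1)) hs.2 hc hg
  have hB0 : 0 ≤ B := (abs_nonneg _).trans (hB s hs)
  set band := (Icc (f s - c / 2) (f s + c / 2)).indicator (1 : ℝ → ℝ)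
  have defect_le : ∀ z, ‖(crossings f z c a b : ℝ) * g z -
      ((crossings f z c a s : ℝ) * g z + (crossings f z c s b : ℝ) * g z)‖ ≤ 2 * B * band z := by
    intro z
    have defect_nonneg : (crossings f z c a s : ℝ) + crossings f z c s b ≤ crossings f z c a b := by
      exact_mod_cast crossings_add_le hf hs hc
    have defect_le_band : (crossings f z c a b : ℝ) - (crossings f z c a s + crossings f z c s b) ≤
        2 * band z := by linarith [crossings_le_add_indicator (z := z) hf hs hc]
    rw [← add_mul, ← sub_mul, norm_mul, Real.norm_eq_abs, Real.norm_eq_abs,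
      abs_of_nonneg (by linarith)]
    by_cases hz : crossings f z c a b = 0
    · rw [hz, Nat.cast_zero] at defect_nonneg ⊢
      have : (0 : ℝ) ≤ crossings f z c a s := Nat.cast_nonneg _
      have : (0 : ℝ) ≤ crossings f z c s b := Nat.cast_nonneg _
      rw [show (0 : ℝ) - (crossings f z c a s + crossings f z c s b) = 0 by linarith, zero_mul]
      exact mul_nonneg (by positivity) (indicator_nonneg (fun _ _ => zero_le_one) z)
    · obtain ⟨u, hu, rfl⟩ := mem_image_of_crossings_ne_zero hf (hs.1.trans hs.2) hc hz
      calc _ ≤ 2 * band (f u) * B :=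
            mul_le_mul defect_le_band (hB u hu) (abs_nonneg _) (by linarith)
        _ = 2 * B * band (f u) := by ring
  rw [← integral_add' left right,
    ← integral_sub' (integrable_crossings_mul hf (hs.1.trans hs.2) hc hg) (left.add right)]
  refine (norm_integral_le_of_norm_le ((integrable_indicator_Icc_one _ _).const_mul (2 * B))
    (ae_of_all _ defect_le)).trans_eq ?_
  rw [integral_const_mul, integral_indicator_Icc_one (by linarith)]
  ring

theorem abs_integral_crossings_mul_sub_le {y ω : ℝ} (hf : ContinuousOn f (Icc a b)) (hab : a ≤ b)
    (hc : 0 < c) (hg : Continuous g) (hω : ∀ u ∈ Icc a b, |g (f u) - y| ≤ ω) :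
    |(∫ z, (crossings f z c a b : ℝ) * g z) - totalCrossings f c a b * y| ≤
      ω * totalCrossings f c a b := by
  have hN := integrable_crossings hf hab hc
  have pointwise_le : ∀ z, ‖(crossings f z c a b : ℝ) * g z - crossings f z c a b * y‖ ≤
      ω * crossings f z c a b := by
    intro z
    rw [← mul_sub, norm_mul, Real.norm_natCast, mul_comm]
    by_cases hz : crossings f z c a b = 0
    · simp [hz]
    · obtain ⟨u, hu, rfl⟩ := mem_image_of_crossings_ne_zero hf hab hc hz
      exact mul_le_mul_of_nonneg_right (hω u hu) (Nat.cast_nonneg _)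
  rw [totalCrossings, ← integral_mul_const, ← integral_const_mul,
    ← integral_sub (integrable_crossings_mul hf hab hc hg) (hN.mul_const y)]
  exact norm_integral_le_of_norm_le (hN.const_mul ω) (ae_of_all _ pointwise_le)

theorem abs_integral_crossings_mul_le (hf : ContinuousOn f (Icc a b)) (hab : a ≤ b) (hc : 0 < c)
    (hg : Continuous g) (hB : ∀ u ∈ Icc a b, |g (f u)| ≤ B) :
    |∫ z, (crossings f z c a b : ℝ) * g z| ≤ B * totalCrossings f c a b := by
  simpa using abs_integral_crossings_mul_sub_le (y := 0) hf hab hc hg (by simpa using hB)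

end TotalCrossings

/-! ### Truncated variation -/

/-- `PartitionSum f c b a w`: there is a partition `a = u₀ ≤ … ≤ uₙ = b`, `n ≥ 1`, with
`∑ (|f uᵢ₊₁ - f uᵢ| - c) = w`. The summands are not truncated at `0`, so that `w` is a lower bound
for the truncated variation which is easy to compute when partitions are concatenated or rescaled.
-/
inductive PartitionSum (f : ℝ → ℝ) (c b : ℝ) : ℝ → ℝ → Prop
  | single {a : ℝ} : a ≤ b → PartitionSum f c b a (|f b - f a| - c)
  | cons {a s w : ℝ} : a ≤ s → PartitionSum f c b s w →
      PartitionSum f c b a (|f s - f a| - c + w)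

namespace PartitionSum

variable {f : ℝ → ℝ} {a b s c w w' : ℝ}

theorem le (h : PartitionSum f c b a w) : a ≤ b := by
  induction h with
  | single h => exact h
  | cons h _ ih => exact h.trans ih

theorem append (h : PartitionSum f c s a w) (h' : PartitionSum f c b s w') :
    PartitionSum f c b a (w + w') := by
  induction h with
  | single h => exact .cons h h'
  | cons h _ ih => rw [add_assoc]; exact .cons h ih

/-- The increments on both sides of `s` have the same sign, so removing `s` from the partition saves
one `c`. -/
theorem join (h : PartitionSum f c s a w) (h' : PartitionSum f c b s w')
    (hmax : IsMaxOn f (Icc a s) s) (hmin : IsMinOn f (Icc s b) s) :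
    PartitionSum f c b a (w + w' + c) := by
  induction h with
  | @single a has =>
    have add_increment : ∀ t ∈ Icc s b, |f t - f a| = |f s - f a| + |f t - f s| := by
      intro t ht
      have : f a ≤ f s := hmax ⟨le_rfl, has⟩
      have : f s ≤ f t := hmin ht
      rw [abs_of_nonneg (by linarith), abs_of_nonneg (by linarith), abs_of_nonneg (by linarith)]
      ring
    cases h' with
    | single hsb =>
      convert! single (has.trans hsb) using 1
      rw [add_increment b ⟨hsb, le_rfl⟩]
      ring
    | @cons _ t w' hst h' =>
      convert! cons (has.trans hst) h' using 1
      rw [add_increment t ⟨hst, h'.le⟩]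
      ring
  | cons has _ ih =>
    convert! cons has (ih (hmax.on_subset (Icc_subset_Icc_left has))) using 1
    ring

theorem map {g : ℝ → ℝ} {φ : ℝ → ℝ} {k : ℝ} (h : PartitionSum f c b a w)
    (hφ : MonotoneOn φ (Icc a b))
    (hg : ∀ u ∈ Icc a b, ∀ v ∈ Icc a b, |g (φ u) - g (φ v)| = k * |f u - f v|) :
    PartitionSum g (k * c) (φ b) (φ a) (k * w) := by
  induction h with
  | @single a hab =>
    convert! single (f := g) (c := k * c) (hφ ⟨le_rfl, hab⟩ ⟨hab, le_rfl⟩ hab) using 1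
    rw [hg b ⟨hab, le_rfl⟩ a ⟨le_rfl, hab⟩]
    ring
  | @cons a s w has h ih =>
    have hsub : Icc s b ⊆ Icc a b := Icc_subset_Icc_left has
    have tail := ih (hφ.mono hsub) fun u hu v hv => hg u (hsub hu) v (hsub hv)
    convert! cons (hφ ⟨le_rfl, has.trans h.le⟩ ⟨has, h.le⟩ has) tail using 1
    rw [hg s ⟨has, h.le⟩ a ⟨le_rfl, has.trans h.le⟩]
    ring

theorem exists_monotone (h : PartitionSum f c b a w) :
    ∃ (n : ℕ) (u : ℕ → ℝ), (Monotone u ∧ u 0 = a ∧ u n = b) ∧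
      w ≤ ∑ i ∈ Finset.range n, max (|f (u (i + 1)) - f (u i)| - c) 0 := by
  induction h with
  | @single a hab =>
    refine ⟨1, fun i => Nat.casesOn i a fun _ => b, ⟨monotone_nat_of_le_succ ?_, rfl, rfl⟩, ?_⟩
    · rintro (_ | i)
      · exact hab
      · exact le_rfl
    · simp
  | @cons a s w has _ ih =>
    obtain ⟨n, u, ⟨hu, rfl, hun⟩, hw⟩ := ih
    refine ⟨n + 1, fun i => Nat.casesOn i a u, ⟨monotone_nat_of_le_succ ?_, rfl, hun⟩, ?_⟩
    · rintro (_ | i)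
      · exact has
      · exact hu i.le_succ
    · rw [Finset.sum_range_succ', add_comm]
      exact add_le_add hw (le_max_left _ _)

theorem ofReal_le_truncatedVariation (h : PartitionSum f c b a w) :
    ENNReal.ofReal w ≤ truncatedVariation f a b c := by
  obtain ⟨n, u, hu, hw⟩ := h.exists_monotone
  refine (ENNReal.ofReal_le_ofReal hw).trans ?_
  rw [ENNReal.ofReal_sum_of_nonneg fun _ _ => le_max_right _ _]
  exact le_iSup₂_of_le n u (le_iSup_of_le hu le_rfl)

end PartitionSum

section Indicatrix

variable {f : ℝ → ℝ} {a b c z : ℝ} {u : ℕ → ℝ} {n : ℕ}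

theorem sum_ite_le_downcrossings (hf : ContinuousOn f (Icc a b)) (hc : 0 < c)
    (hu : Monotone u) (hu0 : u 0 = a) (hun : u n = b) :
    (∑ i ∈ Finset.range n, open Classical in
      if z + c / 2 ≤ f (u i) ∧ f (u (i + 1)) < z - c / 2 then 1 else 0) ≤
      downcrossings f z c a b := by
  have hab : a ≤ b := by rw [← hu0, ← hun]; exact hu n.zero_le
  rw [le_downcrossings_iff hf hab hc, ← hun]
  clear hun
  induction n with
  | zero => exact .zero hu0.ge
  | succ n ih =>
    rw [Finset.sum_range_succ]
    split_ifs with h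
    · rw [Nat.add_comm (Finset.sum _ _)]
      exact ih.append (m := 1) (.succ le_rfl (hu n.le_succ) h.1 h.2 (.zero le_rfl))
    · exact ih.mono_right (hu n.le_succ)

theorem sum_indicator_le_crossings (hf : ContinuousOn f (Icc a b)) (hc : 0 < c)
    (hu : Monotone u) (hu0 : u 0 = a) (hun : u n = b) :
    ∑ i ∈ Finset.range n, (Ioo (min (f (u i)) (f (u (i + 1))) + c / 2)
      (max (f (u i)) (f (u (i + 1))) - c / 2)).indicator (1 : ℝ → ℝ) z ≤ crossings f z c a b := by
  classical
  refine le_trans ?_ (Nat.cast_le.2 (add_le_add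
    (sum_ite_le_downcrossings (z := -z) hf.neg hc hu hu0 hun)
    (sum_ite_le_downcrossings (z := z) hf hc hu hu0 hun)))
  rw [← Finset.sum_add_distrib, Nat.cast_sum]
  refine Finset.sum_le_sum fun i _ => ?_
  by_cases hz : z ∈ Ioo (min (f (u i)) (f (u (i + 1))) + c / 2)
      (max (f (u i)) (f (u (i + 1))) - c / 2)
  · rw [indicator_of_mem hz, Pi.one_apply]
    norm_cast
    rcases le_total (f (u i)) (f (u (i + 1))) with h | h
    · rw [min_eq_left h, max_eq_right h] at hz
      rw [if_pos ⟨by linarith [hz.1], by linarith [hz.2]⟩]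
      exact Nat.le_add_right _ _
    · rw [min_eq_right h, max_eq_left h] at hz
      rw [if_pos (c := z + c / 2 ≤ _ ∧ _) ⟨by linarith [hz.2], by linarith [hz.1]⟩]
      exact Nat.le_add_left _ _
  · rw [indicator_of_notMem hz]
    exact Nat.cast_nonneg _

theorem integral_indicator_Ioo_add_half (p q : ℝ) :
    ∫ z, (Ioo (min p q + c / 2) (max p q - c / 2)).indicator (1 : ℝ → ℝ) z =
      max (|q - p| - c) 0 := by
  rw [integral_indicator_one measurableSet_Ioo, Measure.real, Real.volume_Ioo,
    ENNReal.toReal_ofReal', ← max_sub_min_eq_abs]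
  ring_nf

/-- Each increment `f uᵢ₊₁ - f uᵢ` crosses the bands whose centre lies in an interval of length
`|f uᵢ₊₁ - f uᵢ| - c`. -/
theorem truncatedVariation_le_totalCrossings (hf : ContinuousOn f (Icc a b)) (hab : a ≤ b)
    (hc : 0 < c) : truncatedVariation f a b c ≤ ENNReal.ofReal (totalCrossings f c a b) := by
  refine iSup₂_le fun n u => iSup_le fun ⟨hu, hu0, hun⟩ => ?_
  rw [← ENNReal.ofReal_sum_of_nonneg fun _ _ => le_max_right _ _]
  refine ENNReal.ofReal_le_ofReal ?_
  have integrable_band : ∀ p q : ℝ, Integrable ((Ioo p q).indicator (1 : ℝ → ℝ)) volume :=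
    fun p q => (integrable_indicator_iff measurableSet_Ioo).2 (integrableOn_const (by simp))
  simp only [← integral_indicator_Ioo_add_half]
  rw [← integral_finsetSum _ fun i _ => integrable_band _ _]
  exact integral_mono (integrable_finsetSum _ fun i _ => integrable_band _ _)
    (integrable_crossings hf hab hc) fun z => sum_indicator_le_crossings hf hc hu hu0 hun

theorem PartitionSum.le_totalCrossings {w : ℝ} (h : PartitionSum f c b a w)
    (hf : ContinuousOn f (Icc a b)) (hc : 0 < c) : w ≤ totalCrossings f c a b :=
  (ENNReal.ofReal_le_ofReal_iff totalCrossings_nonneg).1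
    (h.ofReal_le_truncatedVariation.trans (truncatedVariation_le_totalCrossings hf h.le hc))

end Indicatrix

/-! ### The normalizing constants -/

section Normalization

variable {p : ℝ}

theorem peanoScale_zpow_mul (hp : 0 < p) (k : ℤ) :
    peanoScale ((3 : ℝ) ^ k * p) = (3 : ℝ) ^ (-k) * peanoScale p := by
  rw [peanoScale, peanoScale, Real.logb_mul (by positivity) hp.ne', ← Real.rpow_intCast 3 k,
    Real.logb_rpow (by norm_num) (by norm_num), ← zpow_add₀ (by norm_num),
    show -((k : ℝ) + Real.logb 3 p) = -Real.logb 3 p + ((-k : ℤ) : ℝ) by push_cast; ring,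
    Int.floor_add_intCast, add_comm]

theorem peanoC_zpow_mul (hp : 0 < p) (k : ℤ) : peanoC ((3 : ℝ) ^ k * p) = peanoC p := by
  have scale_mul_eq : peanoScale ((3 : ℝ) ^ k * p) * ((3 : ℝ) ^ k * p) = peanoScale p * p := by
    rw [peanoScale_zpow_mul hp, zpow_neg]
    field_simp
  rw [peanoC, scale_mul_eq, peanoC]

theorem peanoC_pow_mul (hp : 0 < p) (m : ℕ) : peanoC (3 ^ m * p) = peanoC p := by
  simpa using peanoC_zpow_mul hp m

theorem peanoScale_mul_mem (hp : 0 < p) : peanoScale p * p ∈ Ioc (1 / 3 : ℝ) 1 := by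
  have scale_mul_eq :
      peanoScale p * p = (3 : ℝ) ^ ((⌊-Real.logb 3 p⌋ : ℝ) + Real.logb 3 p) := by
    rw [Real.rpow_add (by norm_num), Real.rpow_logb (by norm_num) (by norm_num) hp,
      Real.rpow_intCast, peanoScale]
  have floor_le := Int.floor_le (-Real.logb 3 p)
  have lt_floor := Int.lt_floor_add_one (-Real.logb 3 p)
  rw [scale_mul_eq]
  constructor
  · rw [show (1 / 3 : ℝ) = 3 ^ (-1 : ℝ) by rw [Real.rpow_neg_one]; norm_num]
    exact Real.rpow_lt_rpow_of_exponent_lt (by norm_num) (by linarith)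
  · exact Real.rpow_le_one_of_one_le_of_nonpos (by norm_num) (by linarith)

theorem peanoScale_eq_zpow {n : ℤ} (hl : (3 : ℝ) ^ (-(n + 1)) < p) (hr : p ≤ (3 : ℝ) ^ (-n)) :
    peanoScale p = (3 : ℝ) ^ n := by
  have hp : 0 < p := lt_trans (by positivity) hl
  have logb_le : Real.logb 3 p ≤ -n := by
    rwa [Real.logb_le_iff_le_rpow (by norm_num) hp, ← Int.cast_neg, Real.rpow_intCast]
  have lt_logb : -(n + 1 : ℝ) < Real.logb 3 p := by
    rw [Real.lt_logb_iff_rpow_lt (by norm_num) hp]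
    exact_mod_cast hl
  rw [peanoScale, Int.floor_eq_iff.2 ⟨by linarith, by linarith⟩]

theorem peanoC_mem (hp : 0 < p) : peanoC p ∈ Icc (1 / 4 : ℝ) 1 := by
  obtain ⟨hlt, hle⟩ := peanoScale_mul_mem hp
  rw [peanoC]
  constructor <;> nlinarith

theorem peanoC_of_mem_Ioc (hp : p ∈ Ioc (1 / 3 : ℝ) 1) : peanoC p = p * (1 - 3 / 4 * p) := by
  rw [peanoC, peanoScale_eq_zpow (n := 0) (by norm_num; linarith [hp.1]) (by simpa using hp.2),
    zpow_zero, one_mul]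

end Normalization

theorem triadic_induction {P : ℝ → Prop} (base : ∀ c ∈ Ioc (1 / 3 : ℝ) 1, P c)
    (step : ∀ c : ℝ, 0 < c → P (3 * c) → P c) {c : ℝ} (hc0 : 0 < c) (hc1 : c ≤ 1) : P c := by
  obtain ⟨n, hn⟩ := exists_pow_lt_of_lt_one hc0 (show (1 / 3 : ℝ) < 1 by norm_num)
  induction n generalizing c with
  | zero => rw [pow_zero] at hn; linarith
  | succ n ih =>
    rw [pow_succ] at hn
    rcases le_or_gt (3 * c) 1 with h | h
    · exact step c hc0 (ih (by linarith) h (by linarith))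
    · exact base c ⟨by linarith, hc1⟩

/-! ### The mean number of crossings of the Peano coordinate -/

section PeanoCrossings

variable {c : ℝ}

theorem continuousOn_peanoX_Icc {u v : ℝ} (hu : 0 ≤ u) (hv : v ≤ 1) :
    ContinuousOn peanoX (Icc u v) :=
  continuousOn_peanoX.mono (Icc_subset_Icc hu hv)

theorem totalCrossings_peanoCell_le {m i : ℕ} (hi : i < 9 ^ m) (hc : 0 < c) :
    totalCrossings peanoX c (i / 9 ^ m) ((i + 1) / 9 ^ m) ≤
      (1 / 3) ^ m * totalCrossings peanoX (3 ^ m * c) 0 1 := by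
  obtain ⟨A, k, hk, hx⟩ := exists_peanoX_eq_of_mem_cell hi
  have hk0 : k ≠ 0 := abs_pos.1 (hk ▸ by positivity)
  have h := totalCrossings_le_of_affine (φ := fun t => 9 ^ m * t - i)
    (continuousOn_peanoX.mono (peanoCell_subset hi)) (by gcongr; linarith) hc continuousOn_peanoX
    (fun u _ v _ huv => by dsimp only; gcongr) (by field_simp; simp) (by field_simp; linarith) hk0
    hx
  rwa [hk, show c / (1 / 3) ^ m = 3 ^ m * c by rw [one_div, inv_pow]; field_simp] at h

theorem totalCrossings_subcell_le {a b : ℕ} (ha : a < 3) (hb : b < 3) (hc : 0 < c) :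
    totalCrossings peanoX c ((3 * a + b) / 9) ((3 * a + b + 1) / 9) ≤
      totalCrossings peanoX (3 * c) 0 1 / 3 := by
  have h := totalCrossings_peanoCell_le (m := 1) (i := 3 * a + b) (by omega) hc
  push_cast at h
  simp only [pow_one] at h
  linarith

/-- Inside a column the curve goes from the minimal to the maximal abscissa three times, so that the
joints of subcells are extrema and no crossing is lost there. -/
theorem totalCrossings_column_le {a : ℕ} (ha : a < 3) (hc : 0 < c) :
    totalCrossings peanoX c (a / 3) ((a + 1) / 3) ≤ totalCrossings peanoX (3 * c) 0 1 := by
  have : (a : ℝ) ≤ 2 := by exact_mod_cast Nat.le_of_lt_succ ha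
  have : (0 : ℝ) ≤ a := a.cast_nonneg
  have top_eq : peanoX ((3 * a + 1) / 9) = (a + 1) / 3 := by
    simpa [peanoX_one] using peanoX_subcell ha (b := 0) (s := 1) (by norm_num) (by norm_num)
  have bottom_eq : peanoX ((3 * a + 2) / 9) = a / 3 := by
    simpa [peanoX_zero] using peanoX_subcell ha (b := 2) (s := 0) (by norm_num) (by norm_num)
  have split_top := totalCrossings_le_add_of_isMaxOn
    (continuousOn_peanoX_Icc (u := a / 3) (v := (a + 1) / 3) (by positivity) (by linarith))
    (s := (3 * a + 1) / 9) ⟨by linarith, by linarith⟩ hc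
    fun u hu => (peanoX_mem_column ha hu).2.trans_eq top_eq.symm
  have split_bottom := totalCrossings_le_add_of_isMinOn
    (continuousOn_peanoX_Icc (u := (3 * a + 1) / 9) (v := (a + 1) / 3) (by positivity)
      (by linarith)) (s := (3 * a + 2) / 9) ⟨by linarith, by linarith⟩ hc
    fun u hu => bottom_eq.trans_le (peanoX_mem_column ha ⟨by linarith [hu.1], hu.2⟩).1
  have first := totalCrossings_subcell_le ha (b := 0) (by norm_num) hc
  have second := totalCrossings_subcell_le ha (b := 1) (by norm_num) hc
  have third := totalCrossings_subcell_le ha (b := 2) (by norm_num) hc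
  push_cast at first second third
  rw [show ((3 : ℝ) * a + 0) / 9 = a / 3 by ring, add_zero] at first
  rw [show (3 * a + 1 + 1 : ℝ) = 3 * a + 2 by ring] at second
  rw [show (3 * a + 2 + 1 : ℝ) / 9 = (a + 1) / 3 by ring] at third
  linarith

theorem totalCrossings_columns_le {a : ℕ} (ha1 : 1 ≤ a) (ha3 : a ≤ 3) (hc : 0 < c) :
    totalCrossings peanoX c 0 (a / 3) ≤
      a * totalCrossings peanoX (3 * c) 0 1 + (a - 1) * c := by
  induction a, ha1 using Nat.le_induction with
  | base => simpa using totalCrossings_column_le (a := 0) (by norm_num) hc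
  | succ a _ ih =>
    have hle : ((a + 1 : ℕ) : ℝ) / 3 ≤ 1 := by
      rw [div_le_one (by norm_num)]; exact_mod_cast ha3
    have split := totalCrossings_le_add_of_isMaxOn_left (s := a / 3)
      (continuousOn_peanoX_Icc le_rfl hle) ⟨by positivity, by gcongr; linarith⟩ hc
      fun u hu => (peanoX_le_of_mem_Icc (by omega) hu).trans_eq
        (peanoX_natCast_div_three (by omega)).symm
    have column_le := totalCrossings_column_le (a := a) (by omega) hc
    push_cast at split ⊢
    linarith [ih (by omega)]

theorem downcrossings_peanoX_eq_zero {z : ℝ} (hc : 1 / 3 < c) :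
    downcrossings peanoX z c 0 1 = 0 := by
  by_contra h
  cases (le_downcrossings_iff continuousOn_peanoX zero_le_one (by linarith)).1
    (Nat.one_le_iff_ne_zero.2 h) with
  | succ h0u huv hu hv hrest => linarith [peanoX_sub_le_third h0u huv hrest.le]

theorem upcrossings_peanoX_le_one {z : ℝ} (hc : 1 / 3 < c) :
    downcrossings (fun u => -peanoX u) (-z) c 0 1 ≤ 1 := by
  by_contra! h
  cases (le_downcrossings_iff continuousOn_peanoX.neg zero_le_one (by linarith)).1 h with
  | @succ _ u v _ h0u huv _ hv hrest =>
    cases hrest with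
    | @succ _ u' v' _ hvu' hu'v' hu' _ hrest' =>
      have := peanoX_sub_le_third (h0u.trans huv) hvu' (hu'v'.trans hrest'.le)
      have : -peanoX v < -z - c / 2 := hv
      have : -z + c / 2 ≤ -peanoX u' := hu'
      linarith

theorem totalCrossings_peanoX_le_of_third_lt (hc : c ∈ Ioc (1 / 3 : ℝ) 1) :
    totalCrossings peanoX c 0 1 ≤ 1 - c := by
  have hc0 : 0 < c := by linarith [hc.1]
  have crossings_le_indicator : ∀ z, (crossings peanoX z c 0 1 : ℝ) ≤
      (Icc (c / 2) (1 - c / 2)).indicator 1 z := by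
    intro z
    by_cases hz : z ∈ Icc (c / 2) (1 - c / 2)
    · rw [indicator_of_mem hz, Pi.one_apply, crossings_eq_add, downcrossings_peanoX_eq_zero hc.1,
        add_zero]
      exact_mod_cast upcrossings_peanoX_le_one (z := z) hc.1
    · rw [indicator_of_notMem hz]
      by_contra! h
      obtain ⟨u, -, v, -, hu, hv⟩ :=
        exists_of_crossings_ne_zero continuousOn_peanoX zero_le_one hc0 (by exact_mod_cast h.ne')
      exact hz ⟨by linarith [(peanoX_mem_Icc u).1], by linarith [(peanoX_mem_Icc v).2]⟩
  calc totalCrossings peanoX c 0 1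
      ≤ ∫ z, (Icc (c / 2) (1 - c / 2)).indicator (1 : ℝ → ℝ) z :=
        integral_mono (integrable_crossings continuousOn_peanoX zero_le_one hc0)
          (integrable_indicator_Icc_one _ _) crossings_le_indicator
    _ = 1 - c := by rw [integral_indicator_Icc_one (by linarith [hc.2])]; ring

theorem totalCrossings_peanoX_le (hc0 : 0 < c) (hc1 : c ≤ 1) :
    totalCrossings peanoX c 0 1 ≤ peanoC c / c - c / 4 := by
  refine triadic_induction (P := fun c => totalCrossings peanoX c 0 1 ≤ peanoC c / c - c / 4)
    (fun c hc => ?_) (fun c hc ih => ?_) hc0 hc1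
  · have : c ≠ 0 := by linarith [hc.1]
    refine (totalCrossings_peanoX_le_of_third_lt hc).trans_eq ?_
    rw [peanoC_of_mem_Ioc hc]
    field_simp
    ring
  · have recursion := totalCrossings_columns_le (a := 3) (by norm_num) le_rfl hc
    have peanoC_eq : peanoC (3 * c) = peanoC c := by simpa using peanoC_pow_mul hc 1
    rw [peanoC_eq, show peanoC c / (3 * c) = peanoC c / c / 3 by field_simp] at ih
    norm_num at recursion
    linarith

end PeanoCrossings

section PeanoPartitions

variable {c w : ℝ} {m i n : ℕ}

theorem partitionSum_peanoCell (hi : i < 9 ^ m) (h : PartitionSum peanoX (3 ^ m * c) 1 0 w) :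
    PartitionSum peanoX c ((i + 1) / 9 ^ m) (i / 9 ^ m) ((1 / 3) ^ m * w) := by
  obtain ⟨A, k, hk, hx⟩ := exists_peanoX_cell_eq hi
  have h := h.map (g := peanoX) (φ := fun s => (i + s) / 9 ^ m) (k := (1 / 3) ^ m)
    (fun u _ v _ huv => by dsimp only; gcongr) fun u hu v hv => by
      rw [hx u hu, hx v hv, add_sub_add_left_eq_sub, ← mul_sub, abs_mul, hk]
  rwa [← mul_assoc, ← mul_pow, one_div_mul_cancel three_ne_zero, one_pow, one_mul, add_zero] at h

theorem partitionSum_peanoCells (hn : 1 ≤ n) (hin : i + n ≤ 9 ^ m)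
    (h : PartitionSum peanoX (3 ^ m * c) 1 0 w) :
    PartitionSum peanoX c ((i + n) / 9 ^ m) (i / 9 ^ m) (n * ((1 / 3) ^ m * w)) := by
  induction n, hn using Nat.le_induction with
  | base => simpa using partitionSum_peanoCell (by omega) h
  | succ n _ ih =>
    have last := partitionSum_peanoCell (i := i + n) (by omega) h
    push_cast at last ⊢
    rw [← add_assoc, add_one_mul]
    exact (ih (by omega)).append last

theorem partitionSum_columns {a : ℕ} (ha1 : 1 ≤ a) (ha3 : a ≤ 3)
    (h : PartitionSum peanoX (3 * c) 1 0 w) :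
    PartitionSum peanoX c (a / 3) 0 (a * w + (a - 1) * c) := by
  have column : ∀ a : ℕ, a < 3 → PartitionSum peanoX c ((a + 1) / 3) (a / 3) w := by
    intro a ha
    have h := partitionSum_peanoCells (m := 1) (i := 3 * a) (n := 3) (c := c) (w := w)
      (by norm_num) (by omega) (by simpa using h)
    convert! h using 1 <;> push_cast <;> ring
  induction a, ha1 using Nat.le_induction with
  | base => simpa using column 0 (by norm_num)
  | succ a _ ih =>
    have value_eq := peanoX_natCast_div_three (a := a) (by omega)
    have joined := (ih (by omega)).join (column a (by omega))
      (fun u hu => (peanoX_le_of_mem_Icc (by omega) hu).trans_eq value_eq.symm)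
      (fun u hu => value_eq.trans_le (peanoX_mem_column (by omega) hu).1)
    push_cast
    convert! joined using 1
    ring

theorem partitionSum_peanoX (hc0 : 0 < c) (hc1 : c ≤ 1) :
    PartitionSum peanoX c 1 0 (peanoC c / c - c / 4) := by
  refine triadic_induction (P := fun c => PartitionSum peanoX c 1 0 (peanoC c / c - c / 4))
    (fun c hc => ?_) (fun c hc ih => ?_) hc0 hc1
  · have : c ≠ 0 := by linarith [hc.1]
    convert! PartitionSum.single (f := peanoX) (c := c) (zero_le_one (α := ℝ)) using 1
    rw [peanoC_of_mem_Ioc hc, peanoX_zero, peanoX_one, sub_zero, abs_one]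
    field_simp
    ring
  · have recursion := partitionSum_columns (a := 3) (by norm_num) le_rfl ih
    have peanoC_eq : peanoC (3 * c) = peanoC c := by simpa using peanoC_pow_mul hc 1
    convert! recursion using 1
    · norm_num
    · rw [peanoC_eq]
      field_simp
      norm_num
      ring

end PeanoPartitions

theorem totalCrossings_peanoX {c : ℝ} (hc0 : 0 < c) (hc1 : c ≤ 1) :
    totalCrossings peanoX c 0 1 = peanoC c / c - c / 4 :=
  (totalCrossings_peanoX_le hc0 hc1).antisymm
    ((partitionSum_peanoX hc0 hc1).le_totalCrossings continuousOn_peanoX hc0)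

theorem cell_scaling {c : ℝ} (hc : 0 < c) (m : ℕ) :
    (1 / 3) ^ m * (peanoC (3 ^ m * c) / (3 ^ m * c) - 3 ^ m * c / 4) =
      peanoC c / (9 ^ m * c) - c / 4 := by
  rw [peanoC_pow_mul hc, show (9 : ℝ) = 3 * 3 by norm_num, mul_pow, one_div, inv_pow]
  field_simp

theorem totalCrossings_peanoCell {m i : ℕ} {c : ℝ} (hi : i < 9 ^ m) (hc0 : 0 < c)
    (hc1 : 3 ^ m * c ≤ 1) :
    totalCrossings peanoX c (i / 9 ^ m) ((i + 1) / 9 ^ m) = peanoC c / (9 ^ m * c) - c / 4 := by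
  have hc : 0 < 3 ^ m * c := by positivity
  rw [← cell_scaling hc0]
  refine le_antisymm ?_ ?_
  · rw [← totalCrossings_peanoX hc hc1]
    exact totalCrossings_peanoCell_le hi hc0
  · exact (partitionSum_peanoCell hi (partitionSum_peanoX hc hc1)).le_totalCrossings
      (continuousOn_peanoX.mono (peanoCell_subset hi)) hc0

/-! ### Weighted crossings of the curve -/

/-- The error made when the normalized crossing number of `peanoX` on `[a, b]`, integrated against
`g`, is replaced by `peanoC c` times the integral of `g` along the curve. -/
noncomputable def crossingError (g : ℝ → ℝ) (c a b : ℝ) : ℝ :=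
  c * (∫ z, (crossings peanoX z c a b : ℝ) * g z) - peanoC c * ∫ s in a..b, g (peanoX s)

theorem abs_integral_sub_mul_le {F : ℝ → ℝ} {a b y ω : ℝ} (hF : IntervalIntegrable F volume a b)
    (hab : a ≤ b) (hω : ∀ u ∈ Icc a b, |F u - y| ≤ ω) :
    |(∫ u in a..b, F u) - (b - a) * y| ≤ ω * (b - a) := by
  have h := intervalIntegral.norm_integral_le_of_norm_le_const (f := fun u => F u - y)
    fun u hu => hω u (Ioc_subset_Icc_self (uIoc_of_le hab ▸ hu))
  rwa [intervalIntegral.integral_sub hF intervalIntegrable_const, intervalIntegral.integral_const,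
    smul_eq_mul, abs_of_nonneg (sub_nonneg.2 hab), Real.norm_eq_abs] at h

section CrossingError

variable {g : ℝ → ℝ} {a b c s t B ω : ℝ} {m i : ℕ}

theorem intervalIntegrable_comp_peanoX (hg : Continuous g) (ha : 0 ≤ a) (hab : a ≤ b)
    (hb : b ≤ 1) : IntervalIntegrable (fun s => g (peanoX s)) volume a b :=
  (hg.comp_continuousOn (continuousOn_peanoX_Icc ha hb)).intervalIntegrable_of_Icc hab

theorem abs_crossingError_sub_add_le (hg : Continuous g) (hB : ∀ u, |g (peanoX u)| ≤ B)
    (hc : 0 < c) (ha : 0 ≤ a) (hb : b ≤ 1) (hs : s ∈ Icc a b) :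
    |crossingError g c a b - (crossingError g c a s + crossingError g c s b)| ≤ 2 * B * c ^ 2 := by
  have additivity := abs_integral_crossings_mul_sub_add_le (continuousOn_peanoX_Icc ha hb) hs hc hg
    fun u _ => hB u
  rw [crossingError, ← intervalIntegral.integral_add_adjacent_intervals
    (intervalIntegrable_comp_peanoX hg ha hs.1 (hs.2.trans hb))
    (intervalIntegrable_comp_peanoX hg (ha.trans hs.1) hs.2 hb)]
  calc |_| = c * |(∫ z, (crossings peanoX z c a b : ℝ) * g z) -
        ((∫ z, (crossings peanoX z c a s : ℝ) * g z) +
          ∫ z, (crossings peanoX z c s b : ℝ) * g z)| := by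
        rw [← abs_of_pos hc, ← abs_mul, abs_of_pos hc, crossingError, crossingError]
        ring_nf
    _ ≤ c * (2 * B * c) := by gcongr
    _ = 2 * B * c ^ 2 := by ring

theorem mul_totalCrossings_peanoCell (hi : i < 9 ^ m) (hc0 : 0 < c) (hc1 : 3 ^ m * c ≤ 1) :
    c * totalCrossings peanoX c (i / 9 ^ m) ((i + 1) / 9 ^ m) = peanoC c / 9 ^ m - c ^ 2 / 4 := by
  rw [totalCrossings_peanoCell hi hc0 hc1]
  field_simp

theorem mul_totalCrossings_peanoCell_le (hi : i < 9 ^ m) (hc0 : 0 < c) (hc1 : 3 ^ m * c ≤ 1) :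
    c * totalCrossings peanoX c (i / 9 ^ m) ((i + 1) / 9 ^ m) ≤ 1 / 9 ^ m := by
  rw [mul_totalCrossings_peanoCell hi hc0 hc1]
  have : peanoC c / 9 ^ m ≤ 1 / 9 ^ m := by gcongr; linarith [(peanoC_mem hc0).2]
  linarith [sq_nonneg c]

theorem abs_crossingError_peanoCell_le (hg : Continuous g) (hB : ∀ u, |g (peanoX u)| ≤ B)
    (hω : ∀ u v, |peanoX u - peanoX v| ≤ (1 / 3) ^ m → |g (peanoX u) - g (peanoX v)| ≤ ω)
    (hi : i < 9 ^ m) (hc0 : 0 < c) (hc1 : 3 ^ m * c ≤ 1) :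
    |crossingError g c (i / 9 ^ m) ((i + 1) / 9 ^ m)| ≤ 2 * ω / 9 ^ m + B * c ^ 2 / 4 := by
  have hcell : (i : ℝ) / 9 ^ m ≤ (i + 1) / 9 ^ m := by gcongr; linarith
  have hcont := continuousOn_peanoX.mono (peanoCell_subset hi)
  set y := g (peanoX (i / 9 ^ m))
  have oscillation : ∀ u ∈ peanoCell m i, |g (peanoX u) - y| ≤ ω := fun u hu =>
    hω _ _ (abs_peanoX_sub_le_of_mem_cell hi hu ⟨le_rfl, hcell⟩)
  have hω0 : 0 ≤ ω := (abs_nonneg _).trans (oscillation _ ⟨le_rfl, hcell⟩)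
  have crossings_near := abs_integral_crossings_mul_sub_le hcont hcell hc0 hg oscillation
  have curve_near := abs_integral_sub_mul_le
    (intervalIntegrable_comp_peanoX hg (peanoCell_subset hi ⟨le_rfl, hcell⟩).1 hcell
      (peanoCell_subset hi ⟨hcell, le_rfl⟩).2) hcell oscillation
  set N := ∫ z, (crossings peanoX z c (i / 9 ^ m) ((i + 1) / 9 ^ m) : ℝ) * g z
  set I := ∫ s in (i / 9 ^ m : ℝ)..((i + 1) / 9 ^ m), g (peanoX s)
  set T := totalCrossings peanoX c (i / 9 ^ m) ((i + 1) / 9 ^ m)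
  have hT : c * T = peanoC c / 9 ^ m - c ^ 2 / 4 := mul_totalCrossings_peanoCell hi hc0 hc1
  have hT' : c * T ≤ 1 / 9 ^ m := mul_totalCrossings_peanoCell_le hi hc0 hc1
  rw [← sub_div, add_sub_cancel_left] at curve_near
  obtain ⟨hC0, hC1⟩ := peanoC_mem hc0
  calc |c * N - peanoC c * I|
      = |c * (N - T * y) - c ^ 2 / 4 * y - peanoC c * (I - 1 / 9 ^ m * y)| := by
        congr 1
        linear_combination y * hT
    _ ≤ |c * (N - T * y)| + |c ^ 2 / 4 * y| + |peanoC c * (I - 1 / 9 ^ m * y)| :=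
        (abs_sub _ _).trans (add_le_add_left (abs_sub _ _) _)
    _ = c * |N - T * y| + c ^ 2 / 4 * |y| + peanoC c * |I - 1 / 9 ^ m * y| := by
        simp only [abs_mul, abs_of_pos hc0, abs_of_nonneg (by positivity : 0 ≤ c ^ 2 / 4),
          abs_of_nonneg (by linarith : 0 ≤ peanoC c)]
    _ ≤ c * (ω * T) + c ^ 2 / 4 * B + 1 * (ω * (1 / 9 ^ m)) := by
        gcongr
        exact hB _
    _ ≤ ω * (1 / 9 ^ m) + c ^ 2 / 4 * B + 1 * (ω * (1 / 9 ^ m)) := by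
        rw [mul_left_comm]
        gcongr
    _ = _ := by ring

theorem abs_crossingError_zero_natCast_div_le (hg : Continuous g) (hB : ∀ u, |g (peanoX u)| ≤ B)
    (hω : ∀ u v, |peanoX u - peanoX v| ≤ (1 / 3) ^ m → |g (peanoX u) - g (peanoX v)| ≤ ω)
    (hi : i ≤ 9 ^ m) (hc0 : 0 < c) (hc1 : 3 ^ m * c ≤ 1) :
    |crossingError g c 0 (i / 9 ^ m)| ≤ i * (2 * ω / 9 ^ m + 9 / 4 * B * c ^ 2) := by
  induction i with
  | zero =>
    have h := abs_integral_crossings_mul_le (a := 0) (continuousOn_peanoX_Icc le_rfl zero_le_one)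
      le_rfl hc0 hg fun u _ => hB u
    rw [totalCrossings_self hc0, mul_zero, abs_nonpos_iff] at h
    simp [crossingError, h]
  | succ i ih =>
    have hle : ((i + 1 : ℕ) : ℝ) / 9 ^ m ≤ 1 := by
      rw [div_le_one (by positivity)]
      exact_mod_cast hi
    push_cast at hle ⊢
    have split := abs_crossingError_sub_add_le (s := i / 9 ^ m) hg hB hc0 le_rfl hle
      ⟨by positivity, by gcongr; linarith⟩
    have cell := abs_crossingError_peanoCell_le (i := i) hg hB hω hi hc0 hc1
    have ih := ih (by omega)
    rw [abs_le] at *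
    constructor <;> linarith [split.1, split.2, cell.1, cell.2, ih.1, ih.2]

theorem abs_crossingError_partialCell_le (hg : Continuous g) (hB : ∀ u, |g (peanoX u)| ≤ B)
    (hi : i < 9 ^ m) (hc0 : 0 < c) (hc1 : 3 ^ m * c ≤ 1) (ht : t ∈ peanoCell m i) :
    |crossingError g c (i / 9 ^ m) t| ≤ 2 * B / 9 ^ m := by
  have ht1 : t ≤ 1 := (peanoCell_subset hi ht).2
  have hB0 : 0 ≤ B := (abs_nonneg _).trans (hB 0)
  obtain ⟨hC0, hC1⟩ := peanoC_mem hc0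
  have crossings_le : |c * ∫ z, (crossings peanoX z c (i / 9 ^ m) t : ℝ) * g z| ≤ B / 9 ^ m :=
    calc |_| ≤ c * (B * totalCrossings peanoX c (i / 9 ^ m) t) := by
          rw [abs_mul, abs_of_pos hc0]
          gcongr
          exact abs_integral_crossings_mul_le (continuousOn_peanoX_Icc (by positivity) ht1)
            ht.1 hc0 hg fun u _ => hB u
      _ ≤ c * (B * totalCrossings peanoX c (i / 9 ^ m) ((i + 1) / 9 ^ m)) := by
          gcongr
          have := totalCrossings_add_le (continuousOn_peanoX.mono (peanoCell_subset hi)) ht hc0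
          linarith [totalCrossings_nonneg (f := peanoX) (c := c) (a := t) (b := (i + 1) / 9 ^ m)]
      _ = B * (c * totalCrossings peanoX c (i / 9 ^ m) ((i + 1) / 9 ^ m)) := by ring
      _ ≤ B * (1 / 9 ^ m) := by gcongr; exact mul_totalCrossings_peanoCell_le hi hc0 hc1
      _ = B / 9 ^ m := mul_one_div _ _
  have curve_le : |peanoC c * ∫ s in (i / 9 ^ m : ℝ)..t, g (peanoX s)| ≤ B / 9 ^ m :=
    calc |_| ≤ 1 * (B * (t - i / 9 ^ m)) := by
          rw [abs_mul, abs_of_nonneg (by linarith : 0 ≤ peanoC c)]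
          gcongr
          simpa using abs_integral_sub_mul_le (y := 0)
            (intervalIntegrable_comp_peanoX hg (by positivity) ht.1 ht1) ht.1
            fun u _ => by simpa using hB u
      _ ≤ 1 * (B * (1 / 9 ^ m)) := by
          gcongr
          have := ht.2
          rw [add_div] at this
          linarith
      _ = B / 9 ^ m := by ring
  calc |crossingError g c (i / 9 ^ m) t| ≤ B / 9 ^ m + B / 9 ^ m :=
        (abs_sub _ _).trans (add_le_add crossings_le curve_le)
    _ = 2 * B / 9 ^ m := by ring

theorem abs_crossingError_zero_le (hg : Continuous g) (hB : ∀ u, |g (peanoX u)| ≤ B)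
    (hω : ∀ u v, |peanoX u - peanoX v| ≤ (1 / 3) ^ m → |g (peanoX u) - g (peanoX v)| ≤ ω)
    (hc0 : 0 < c) (hc1 : 3 ^ m * c ≤ 1) (ht : t ∈ Icc (0 : ℝ) 1) :
    |crossingError g c 0 t| ≤ 2 * ω + 2 * B / 9 ^ m + 5 * 9 ^ m * B * c ^ 2 := by
  obtain ⟨i, hi, hti⟩ := exists_mem_peanoCell m ht
  have hB0 : 0 ≤ B := (abs_nonneg _).trans (hB 0)
  have hω0 : 0 ≤ ω := (abs_nonneg _).trans (hω 0 0 (by rw [sub_self, abs_zero]; positivity))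
  have hi' : (i : ℝ) ≤ 9 ^ m := by exact_mod_cast hi.le
  have cells_le : i * (2 * ω / 9 ^ m + 9 / 4 * B * c ^ 2) ≤
      2 * ω + 9 ^ m * (9 / 4 * B * c ^ 2) :=
    calc _ ≤ 9 ^ m * (2 * ω / 9 ^ m + 9 / 4 * B * c ^ 2) := by gcongr
      _ = _ := by field_simp
  have one_le : 1 * (2 * B * c ^ 2) ≤ 9 ^ m * (2 * B * c ^ 2) := by
    gcongr
    exact one_le_pow₀ (by norm_num)
  have split := abs_crossingError_sub_add_le (s := i / 9 ^ m) hg hB hc0 le_rfl ht.2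
    ⟨by positivity, hti.1⟩
  have cells := abs_crossingError_zero_natCast_div_le hg hB hω hi.le hc0 hc1
  have partialCell := abs_crossingError_partialCell_le hg hB hi hc0 hc1 hti
  have : 0 ≤ 9 ^ m * (B * c ^ 2) := by positivity
  rw [abs_le] at *
  constructor <;> linarith [split.1, split.2, cells.1, cells.2, partialCell.1, partialCell.2]

theorem eventually_abs_crossingError_lt (hg : Continuous g) {ε : ℝ} (hε : 0 < ε) :
    ∀ᶠ c in 𝓝[>] 0, ∀ t ∈ Icc (0 : ℝ) 1, |crossingError g c 0 t| < ε := by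
  obtain ⟨B, hB0, hB⟩ : ∃ B > 0, ∀ u, |g (peanoX u)| ≤ B := by
    obtain ⟨B, hB⟩ := isCompact_Icc.exists_bound_of_continuousOn hg.continuousOn
    exact ⟨max B 1, by positivity, fun u => (hB _ (peanoX_mem_Icc u)).trans (le_max_left _ _)⟩
  obtain ⟨δ, hδ, modulus⟩ := Metric.uniformContinuousOn_iff_le.1
    (isCompact_Icc.uniformContinuousOn_of_continuous hg.continuousOn) (ε / 8) (by positivity)
  obtain ⟨m, hm⟩ := exists_pow_lt_of_lt_one (y := (1 / 3 : ℝ))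
    (show 0 < min δ (ε / (8 * B)) by positivity) (by norm_num)
  have cell_le : 2 * B / 9 ^ m < ε / 4 := by
    have : (1 / 9 : ℝ) ^ m ≤ (1 / 3) ^ m := by gcongr; norm_num
    have := this.trans_lt (hm.trans_le (min_le_right _ _))
    rw [lt_div_iff₀ (by positivity), one_div, inv_pow, inv_mul_eq_div] at this
    linarith [mul_div_assoc 2 B ((9 : ℝ) ^ m), mul_div_assoc 8 B ((9 : ℝ) ^ m)]
  have small_level : ∀ᶠ c : ℝ in 𝓝[>] 0, 5 * 9 ^ m * B * c ^ 2 < ε / 2 :=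
    nhdsWithin_le_nhds (ContinuousAt.eventually_lt (by fun_prop) continuousAt_const (by simpa))
  have level_le_cell : ∀ᶠ c : ℝ in 𝓝[>] 0, 3 ^ m * c < 1 :=
    nhdsWithin_le_nhds (ContinuousAt.eventually_lt (by fun_prop) continuousAt_const (by simp))
  filter_upwards [small_level, level_le_cell, self_mem_nhdsWithin] with c hc hc1 hc0 t ht
  have := abs_crossingError_zero_le hg hB (fun u v huv => modulus _ (peanoX_mem_Icc u) _
    (peanoX_mem_Icc v) (huv.trans (hm.le.trans (min_le_left _ _)))) hc0 hc1.le ht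
  linarith

end CrossingError

/-! ### Limits at small levels -/

section Limits

variable {c p t : ℝ} {g : ℝ → ℝ} {m i : ℕ}

theorem partitionSum_peanoX_zero_natCast_div (hi0 : 1 ≤ i) (hi : i ≤ 9 ^ m) (hc0 : 0 < c)
    (hc1 : 3 ^ m * c ≤ 1) :
    PartitionSum peanoX c (i / 9 ^ m) 0 (i * (peanoC c / (9 ^ m * c) - c / 4)) := by
  have h := partitionSum_peanoCells (i := 0) hi0 (by simpa using hi)
    (partitionSum_peanoX (by positivity) hc1)
  rwa [cell_scaling hc0, Nat.cast_zero, zero_add, zero_div] at h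

theorem exists_partitionSum_peanoX (m : ℕ) (hc0 : 0 < c) (hc1 : 3 ^ m * c ≤ 1)
    (ht : t ∈ Icc (0 : ℝ) 1) :
    ∃ w, PartitionSum peanoX c t 0 w ∧ peanoC c * t ≤ c * w + 1 / 9 ^ m + 2 * 9 ^ m * c ^ 2 := by
  obtain ⟨i, hi, hti⟩ := exists_mem_peanoCell m ht
  obtain ⟨hC0, hC1⟩ := peanoC_mem hc0
  have h9 : (1 : ℝ) ≤ 9 ^ m := one_le_pow₀ (by norm_num)
  obtain ⟨w, hw, hle⟩ : ∃ w, PartitionSum peanoX c t 0 w ∧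
      i * (peanoC c / (9 ^ m * c) - c / 4) - c ≤ w := by
    rcases Nat.eq_zero_or_pos i with rfl | hi0
    · refine ⟨_, .single ht.1, ?_⟩
      simp
    · have cells := partitionSum_peanoX_zero_natCast_div hi0 hi.le hc0 hc1
      refine ⟨_, cells.append (.single hti.1), ?_⟩
      linarith [abs_nonneg (peanoX t - peanoX (i / 9 ^ m))]
  refine ⟨w, hw, ?_⟩
  have time_le : peanoC c * t ≤ peanoC c * (i / 9 ^ m) + 1 * (1 / 9 ^ m) :=
    calc _ ≤ peanoC c * (i / 9 ^ m + 1 / 9 ^ m) := by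
          gcongr
          exact hti.2.trans_eq (add_div _ _ _)
      _ ≤ _ := by rw [mul_add]; gcongr
  have cells_le : peanoC c * (i / 9 ^ m) - i * (c ^ 2 / 4) - c ^ 2 ≤ c * w :=
    calc _ = c * (i * (peanoC c / (9 ^ m * c) - c / 4) - c) := by field_simp
      _ ≤ _ := by gcongr
  have count_le : i * (c ^ 2 / 4) ≤ 9 ^ m * (c ^ 2 / 4) := by
    gcongr
    exact_mod_cast hi.le
  have := mul_le_mul_of_nonneg_right h9 (sq_nonneg c)
  linarith [sq_nonneg c]

theorem eventually_mul_truncatedVariation_mem {ε : ℝ} (hε : 0 < ε) :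
    ∀ᶠ c : ℝ in 𝓝[>] 0, ∀ t ∈ Icc (0 : ℝ) 1,
      ENNReal.ofReal c * truncatedVariation peanoX 0 t c ∈
        Icc (ENNReal.ofReal (peanoC c * t - ε)) (ENNReal.ofReal (peanoC c * t + ε)) := by
  obtain ⟨m, hm⟩ := exists_pow_lt_of_lt_one (half_pos hε) (show (1 / 9 : ℝ) < 1 by norm_num)
  rw [one_div_pow] at hm
  have small_level : ∀ᶠ c : ℝ in 𝓝[>] 0, 2 * 9 ^ m * c ^ 2 < ε / 2 :=
    nhdsWithin_le_nhds (ContinuousAt.eventually_lt (by fun_prop) continuousAt_const (by simpa))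
  have level_le_cell : ∀ᶠ c : ℝ in 𝓝[>] 0, 3 ^ m * c < 1 :=
    nhdsWithin_le_nhds (ContinuousAt.eventually_lt (by fun_prop) continuousAt_const (by simp))
  filter_upwards [small_level, level_le_cell, self_mem_nhdsWithin,
    eventually_abs_crossingError_lt (continuous_const (y := (1 : ℝ))) hε] with c hc hc1 hc0 hE t ht
  replace hc0 : 0 < c := hc0
  constructor
  · obtain ⟨w, hw, hle⟩ := exists_partitionSum_peanoX m hc0 hc1.le ht
    calc ENNReal.ofReal (peanoC c * t - ε) ≤ ENNReal.ofReal (c * w) :=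
          ENNReal.ofReal_le_ofReal (by linarith)
      _ = ENNReal.ofReal c * ENNReal.ofReal w := ENNReal.ofReal_mul hc0.le
      _ ≤ _ := by gcongr; exact hw.ofReal_le_truncatedVariation
  · have hE := (abs_lt.1 (hE t ht)).2
    simp only [crossingError, mul_one, intervalIntegral.integral_const, smul_eq_mul,
      sub_zero] at hE
    calc ENNReal.ofReal c * truncatedVariation peanoX 0 t c
        ≤ ENNReal.ofReal c * ENNReal.ofReal (totalCrossings peanoX c 0 t) := by
          gcongr
          exact truncatedVariation_le_totalCrossings (continuousOn_peanoX_Icc le_rfl ht.2) ht.1 hc0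
      _ = ENNReal.ofReal (c * totalCrossings peanoX c 0 t) := (ENNReal.ofReal_mul hc0.le).symm
      _ ≤ _ := ENNReal.ofReal_le_ofReal (by rw [totalCrossings]; linarith)

theorem tendsto_ofReal_of_eventually_mem_Icc {ι : Type*} {l : Filter ι} {X : ι → ℝ≥0∞} {x : ℝ}
    (h : ∀ ε > 0, ∀ᶠ n in l, X n ∈ Icc (ENNReal.ofReal (x - ε)) (ENNReal.ofReal (x + ε))) :
    Tendsto X l (𝓝 (ENNReal.ofReal x)) := by
  have lower : Tendsto (fun ε => ENNReal.ofReal (x - ε)) (𝓝[>] 0) (𝓝 (ENNReal.ofReal x)) :=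
    ((ENNReal.continuous_ofReal.comp (by fun_prop)).tendsto' 0 _ (by simp)).mono_left
      nhdsWithin_le_nhds
  have upper : Tendsto (fun ε => ENNReal.ofReal (x + ε)) (𝓝[>] 0) (𝓝 (ENNReal.ofReal x)) :=
    ((ENNReal.continuous_ofReal.comp (by fun_prop)).tendsto' 0 _ (by simp)).mono_left
      nhdsWithin_le_nhds
  refine tendsto_order.2 ⟨fun a ha => ?_, fun a ha => ?_⟩
  · obtain ⟨ε, hlt, hε⟩ := ((lower.eventually (lt_mem_nhds ha)).and self_mem_nhdsWithin).exists
    filter_upwards [h ε hε] with n hn using hlt.trans_le hn.1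
  · obtain ⟨ε, hlt, hε⟩ := ((upper.eventually (gt_mem_nhds ha)).and self_mem_nhdsWithin).exists
    filter_upwards [h ε hε] with n hn using hn.2.trans_lt hlt

theorem tendsto_three_zpow_neg_mul (hp : 0 < p) :
    Tendsto (fun n : ℕ => (3 : ℝ) ^ (-(n : ℤ)) * p) atTop (𝓝[>] 0) := by
  refine tendsto_nhdsWithin_iff.2 ⟨?_, Eventually.of_forall fun n => ?_⟩
  · have h := (tendsto_pow_atTop_nhds_zero_of_lt_one (r := (3 : ℝ)⁻¹) (by norm_num)
      (by norm_num)).mul_const p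
    simpa only [zpow_neg, zpow_natCast, inv_pow, zero_mul] using h
  · exact mem_Ioi.2 (by positivity)

theorem tendsto_mul_truncatedVariation_peanoX (hp : 0 < p) (ht : t ∈ Icc (0 : ℝ) 1) :
    Tendsto (fun n : ℕ => ENNReal.ofReal ((3 : ℝ) ^ (-(n : ℤ)) * p) *
      truncatedVariation peanoX 0 t ((3 : ℝ) ^ (-(n : ℤ)) * p))
      atTop (𝓝 (ENNReal.ofReal (peanoC p * t))) := by
  refine tendsto_ofReal_of_eventually_mem_Icc fun ε hε => ?_
  filter_upwards [(tendsto_three_zpow_neg_mul hp).eventually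
    (eventually_mul_truncatedVariation_mem hε)] with n hn
  simpa only [peanoC_zpow_mul hp] using hn t ht

theorem tendstoUniformlyOn_mul_integral_crossings_peanoX (hp : 0 < p) (hg : Continuous g) :
    TendstoUniformlyOn
      (fun (n : ℕ) (t : ℝ) => (3 : ℝ) ^ (-(n : ℤ)) * p *
        ∫ z, (crossings peanoX z ((3 : ℝ) ^ (-(n : ℤ)) * p) 0 t : ℝ) * g z)
      (fun t => peanoC p * ∫ s in (0 : ℝ)..t, g (peanoX s)) atTop (Icc (0 : ℝ) 1) := by
  rw [Metric.tendstoUniformlyOn_iff]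
  intro ε hε
  filter_upwards [(tendsto_three_zpow_neg_mul hp).eventually
    (eventually_abs_crossingError_lt hg hε)] with n hn t ht
  rw [dist_comm, Real.dist_eq]
  simpa only [crossingError, peanoC_zpow_mul hp] using hn t ht

theorem tendsto_integral_peanoPhi_mul_crossings (hg : Continuous g) (ht : t ∈ Icc (0 : ℝ) 1) :
    Tendsto (fun c : ℝ => ∫ z, peanoPhi c * (crossings peanoX z c 0 t : ℝ) * g z)
      (𝓝[>] 0) (𝓝 (∫ s in (0 : ℝ)..t, g (peanoX s))) := by
  rw [Metric.tendsto_nhds]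
  intro ε hε
  filter_upwards [self_mem_nhdsWithin,
    eventually_abs_crossingError_lt hg (show 0 < ε / 4 by linarith)] with c hc0 hE
  have hC := (peanoC_mem hc0).1
  have hC0 : 0 < peanoC c := by linarith
  have error_eq : (∫ z, peanoPhi c * (crossings peanoX z c 0 t : ℝ) * g z) -
      ∫ s in (0 : ℝ)..t, g (peanoX s) = crossingError g c 0 t / peanoC c := by
    simp only [mul_assoc, integral_const_mul, peanoPhi, crossingError]
    field_simp
  rw [Real.dist_eq, error_eq, abs_div, abs_of_pos hC0, div_lt_iff₀ hC0]
  calc |crossingError g c 0 t| < ε * (1 / 4) := by linarith [hE t ht]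
    _ ≤ ε * peanoC c := by gcongr

end Limits

/-! ### The normalization -/

theorem peanoPhi_eq {c : ℝ} (hc : 0 < c) :
    peanoPhi c = 1 / (peanoScale c * (1 - 3 / 4 * (peanoScale c * c))) := by
  rw [peanoPhi, peanoC, mul_right_comm, mul_comm _ c, div_mul_eq_div_div, div_self hc.ne']

theorem peanoPhi_pos {c : ℝ} (hc : 0 < c) : 0 < peanoPhi c :=
  div_pos hc (by linarith [(peanoC_mem hc).1])

theorem peanoPhi_le {c : ℝ} (hc : 0 < c) : peanoPhi c ≤ 4 * c := by
  have hC := (peanoC_mem hc).1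
  rw [peanoPhi, div_le_iff₀ (by linarith)]
  nlinarith

theorem tendsto_peanoPhi : Tendsto peanoPhi (𝓝[>] 0) (𝓝 0) := by
  have four_mul : Tendsto (fun c : ℝ => 4 * c) (𝓝[>] 0) (𝓝 0) :=
    (Continuous.tendsto' (by fun_prop) 0 0 (by simp)).mono_left nhdsWithin_le_nhds
  refine squeeze_zero' ?_ ?_ four_mul
  · filter_upwards [self_mem_nhdsWithin] with c hc using (peanoPhi_pos hc).le
  · filter_upwards [self_mem_nhdsWithin] with c hc using peanoPhi_le hc

theorem inv_peanoPhi_eq {n : ℤ} {p : ℝ} (hp : p ∈ Ioc ((3 : ℝ) ^ (-(n + 1))) (3 ^ (-n))) :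
    (peanoPhi p)⁻¹ = (3 : ℝ) ^ n * (1 - 3 / 4 * ((3 : ℝ) ^ n * p)) := by
  rw [peanoPhi_eq (lt_trans (by positivity) hp.1), peanoScale_eq_zpow hp.1 hp.2, one_div, inv_inv]

theorem hasDerivAt_mul_one_sub (k a : ℝ) :
    HasDerivAt (fun p : ℝ => k * (1 - 3 / 4 * (k * p))) (-(3 / 4) * k ^ 2) a := by
  have h := (((hasDerivAt_id a).const_mul k).const_mul (3 / 4)).const_sub 1 |>.const_mul k
  convert! h using 1
  ring

theorem hasDerivWithinAt_inv_peanoPhi_Iic (n : ℤ) :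
    HasDerivWithinAt peanoPhi⁻¹ (-(3 / 4) * ((3 : ℝ) ^ n) ^ 2) (Iic (3 ^ (-n))) (3 ^ (-n)) := by
  have hlt : (3 : ℝ) ^ (-(n + 1)) < 3 ^ (-n) := zpow_lt_zpow_right₀ (by norm_num) (by omega)
  have hEq : peanoPhi⁻¹ =ᶠ[𝓝[≤] (3 ^ (-n))]
      fun p => (3 : ℝ) ^ n * (1 - 3 / 4 * ((3 : ℝ) ^ n * p)) := by
    filter_upwards [self_mem_nhdsWithin, nhdsWithin_le_nhds (Ioi_mem_nhds hlt)] with p hp hp'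
      using inv_peanoPhi_eq ⟨hp', hp⟩
  exact (hasDerivAt_mul_one_sub _ _).hasDerivWithinAt.congr_of_eventuallyEq hEq
    (hEq.self_of_nhdsWithin self_mem_Iic)

theorem hasDerivWithinAt_inv_peanoPhi_Ici (n : ℤ) :
    HasDerivWithinAt peanoPhi⁻¹ (-(3 / 4) * ((3 : ℝ) ^ (n - 1)) ^ 2) (Ici (3 ^ (-n)))
      (3 ^ (-n)) := by
  have hlt : (3 : ℝ) ^ (-(n + 1)) < 3 ^ (-n) := zpow_lt_zpow_right₀ (by norm_num) (by omega)
  have hlt' : (3 : ℝ) ^ (-n) < 3 ^ (-(n - 1)) := zpow_lt_zpow_right₀ (by norm_num) (by omega)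
  have right_branch : ∀ p ∈ Ioc ((3 : ℝ) ^ (-n)) (3 ^ (-(n - 1))), (peanoPhi p)⁻¹ =
      (3 : ℝ) ^ (n - 1) * (1 - 3 / 4 * ((3 : ℝ) ^ (n - 1) * p)) :=
    fun p hp => inv_peanoPhi_eq (by rwa [sub_add_cancel])
  have hEq : peanoPhi⁻¹ =ᶠ[𝓝[≥] (3 ^ (-n))]
      fun p => (3 : ℝ) ^ (n - 1) * (1 - 3 / 4 * ((3 : ℝ) ^ (n - 1) * p)) := by
    filter_upwards [self_mem_nhdsWithin, nhdsWithin_le_nhds (Iio_mem_nhds hlt')] with p hp hp'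
    rcases (show (3 : ℝ) ^ (-n) ≤ p from hp).eq_or_lt with rfl | hgt
    -- the two branches agree at `3 ^ (-n)` because `1 - 3/4 = 1/3 * (1 - 3/4 * 1/3)`
    · rw [Pi.inv_apply, inv_peanoPhi_eq ⟨hlt, le_rfl⟩, zpow_sub_one₀ (by norm_num), zpow_neg]
      field_simp
      norm_num
    · exact right_branch p ⟨hgt, (show p < _ from hp').le⟩
  exact (hasDerivAt_mul_one_sub _ _).hasDerivWithinAt.congr_of_eventuallyEq hEq
    (hEq.self_of_nhdsWithin self_mem_Ici)

theorem not_differentiableAt_peanoPhi (n : ℤ) :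
    ¬ DifferentiableAt ℝ peanoPhi ((3 : ℝ) ^ (-n)) := by
  intro h
  have hd := (h.inv (peanoPhi_pos (by positivity)).ne').hasDerivAt
  have left := (uniqueDiffWithinAt_Iic _).eq_deriv _ hd.hasDerivWithinAt
    (hasDerivWithinAt_inv_peanoPhi_Iic n)
  have right := (uniqueDiffWithinAt_Ici _).eq_deriv _ hd.hasDerivWithinAt
    (hasDerivWithinAt_inv_peanoPhi_Ici n)
  rw [left, zpow_sub_one₀ (by norm_num)] at right
  have : (0 : ℝ) < ((3 : ℝ) ^ n) ^ 2 := by positivity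
  nlinarith

/-! ### The occupation measure -/

theorem integral_zero_one_eq_average {F : ℝ → ℝ} {N : ℕ} (hF : ContinuousOn F (Icc 0 1))
    (hN : 0 < N) :
    ∫ s in (0 : ℝ)..1, F s =
      (1 / N) * ∑ k ∈ Finset.range N, ∫ s in (0 : ℝ)..1, F ((k + s) / N) := by
  have hN' : (0 : ℝ) < N := by exact_mod_cast hN
  have adjacent := intervalIntegral.sum_integral_adjacent_intervals (μ := volume)
    (f := F) (a := fun i : ℕ => (i : ℝ) / N) (n := N) fun k hk => by
      have : ((k + 1 : ℕ) : ℝ) ≤ N := by exact_mod_cast hk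
      refine (hF.mono (uIcc_subset_Icc ⟨by positivity, ?_⟩ ⟨by positivity, ?_⟩)).intervalIntegrable
        <;> rw [div_le_one hN']
      · exact_mod_cast hk.le
      · exact this
  rw [Nat.cast_zero, zero_div, div_self hN'.ne'] at adjacent
  rw [← adjacent, Finset.mul_sum]
  refine Finset.sum_congr rfl fun k _ => ?_
  have rescale := intervalIntegral.integral_comp_div_add (a := 0) (b := 1) F hN'.ne' ((k : ℝ) / N)
  simp only [add_div, add_comm ((k : ℝ) / N), Nat.cast_add, Nat.cast_one, rescale, smul_eq_mul,
    ← mul_assoc, one_div_mul_cancel hN'.ne', one_mul, zero_div, zero_add]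

theorem abs_integral_zero_one_sub_average_le {F : ℝ → ℝ} {N : ℕ} {I : ℕ → ℝ} {ε : ℝ}
    (hF : ContinuousOn F (Icc 0 1)) (hN : 0 < N)
    (hI : ∀ k < N, |(∫ s in (0 : ℝ)..1, F ((k + s) / N)) - I k| ≤ ε) :
    |(∫ s in (0 : ℝ)..1, F s) - (1 / N) * ∑ k ∈ Finset.range N, I k| ≤ ε := by
  have hN' : (0 : ℝ) < N := by exact_mod_cast hN
  rw [integral_zero_one_eq_average hF hN, ← mul_sub, ← Finset.sum_sub_distrib, abs_mul,
    abs_of_pos (by positivity), one_div_mul_eq_div, div_le_iff₀ hN']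
  calc _ ≤ ∑ k ∈ Finset.range N, |(∫ s in (0 : ℝ)..1, F ((k + s) / N)) - I k| :=
        Finset.abs_sum_le_sum_abs _ _
    _ ≤ N • ε := by
        simpa using Finset.sum_le_card_nsmul _ _ ε fun k hk => hI k (Finset.mem_range.1 hk)
    _ = ε * N := by rw [nsmul_eq_mul, mul_comm]

/-- The nine subcells run over every column three times. -/
theorem abs_integral_comp_peanoX_sub_le_of_subcell {g : ℝ → ℝ} {ε : ℝ} (hg : Continuous g)
    (h : ∀ a < 3, ∀ b < 3, |(∫ s in (0 : ℝ)..1, g (peanoX ((3 * (a : ℕ) + (b : ℕ) + s) / 9))) -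
      ∫ s in (0 : ℝ)..1, g ((a + s) / 3)| ≤ ε) :
    |(∫ s in (0 : ℝ)..1, g (peanoX s)) - ∫ s in (0 : ℝ)..1, g s| ≤ ε := by
  have hcont := hg.comp_continuousOn continuousOn_peanoX
  rw [integral_zero_one_eq_average hg.continuousOn three_pos]
  refine abs_integral_zero_one_sub_average_le hcont three_pos fun a ha => ?_
  have ha' : (a : ℝ) ≤ 2 := by exact_mod_cast Nat.le_of_lt_succ ha
  have column := abs_integral_zero_one_sub_average_le (F := fun s => g (peanoX ((a + s) / 3)))
    (I := fun _ => ∫ s in (0 : ℝ)..1, g ((a + s) / 3)) (N := 3) (ε := ε)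
    (hcont.comp (by fun_prop) fun s hs =>
      ⟨div_nonneg (add_nonneg a.cast_nonneg hs.1) zero_le_three, by linarith [hs.2]⟩)
    three_pos fun b hb => by
      have time_eq : ∀ s : ℝ, (a + (b + s) / (3 : ℕ)) / 3 = (3 * a + b + s) / 9 := fun s => by
        push_cast
        ring
      simpa only [time_eq] using h a ha b hb
  simpa using column

theorem abs_integral_comp_peanoX_sub_le (m : ℕ) {g : ℝ → ℝ} {ε : ℝ} (hg : Continuous g)
    (hω : ∀ y ∈ Icc (0 : ℝ) 1, ∀ z ∈ Icc (0 : ℝ) 1, |y - z| ≤ (1 / 3) ^ m → |g y - g z| ≤ ε) :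
    |(∫ s in (0 : ℝ)..1, g (peanoX s)) - ∫ s in (0 : ℝ)..1, g s| ≤ ε := by
  induction m generalizing g with
  | zero =>
    have hx := intervalIntegrable_comp_peanoX hg le_rfl zero_le_one le_rfl
    have hid := hg.intervalIntegrable (μ := volume) 0 1
    rw [← intervalIntegral.integral_sub hx hid]
    simpa using abs_integral_sub_mul_le (y := 0) (ω := ε) (hx.sub hid) zero_le_one fun s hs => by
      obtain ⟨hx0, hx1⟩ := peanoX_mem_Icc s
      rw [sub_zero]
      exact hω _ ⟨hx0, hx1⟩ _ hs (abs_le.2 ⟨by linarith [hs.2], by linarith [hs.1]⟩)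
  | succ m ih =>
    refine abs_integral_comp_peanoX_sub_le_of_subcell hg fun a ha b hb => ?_
    have ha' : (a : ℝ) ≤ 2 := by exact_mod_cast Nat.le_of_lt_succ ha
    have hmem : ∀ y ∈ Icc (0 : ℝ) 1, (a + y) / 3 ∈ Icc (0 : ℝ) 1 := fun y hy =>
      ⟨div_nonneg (add_nonneg a.cast_nonneg hy.1) zero_le_three, by linarith [hy.2]⟩
    have modulus : ∀ y ∈ Icc (0 : ℝ) 1, ∀ z ∈ Icc (0 : ℝ) 1, |y - z| ≤ (1 / 3) ^ m →
        |g ((a + y) / 3) - g ((a + z) / 3)| ≤ ε := fun y hy z hz hyz => by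
      refine hω _ (hmem y hy) _ (hmem z hz) ?_
      rw [← sub_div, add_sub_add_left_eq_sub, abs_div, abs_of_pos (three_pos (α := ℝ)), pow_succ,
        mul_one_div]
      gcongr
    have subcell_eq : ∫ s in (0 : ℝ)..1, g (peanoX ((3 * a + b + s) / 9)) =
        ∫ s in (0 : ℝ)..1, g ((a + if b = 1 then 1 - peanoX s else peanoX s) / 3) :=
      intervalIntegral.integral_congr fun s hs => congrArg g <|
        peanoX_subcell ha hb (by rwa [uIcc_of_le zero_le_one] at hs)
    rw [subcell_eq]
    split_ifs
    · have flip := intervalIntegral.integral_comp_sub_left (a := 0) (b := 1)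
        (fun y => g ((a + y) / 3)) 1
      rw [sub_self, sub_zero] at flip
      rw [← flip]
      exact ih (g := fun y => g ((a + (1 - y)) / 3)) (by fun_prop) fun y hy z hz hyz =>
        modulus _ (Icc.mem_iff_one_sub_mem.1 hy) _ (Icc.mem_iff_one_sub_mem.1 hz)
          (by rwa [sub_sub_sub_cancel_left, abs_sub_comm])
    · exact ih (g := fun y => g ((a + y) / 3)) (by fun_prop) modulus

theorem integral_comp_peanoX {g : ℝ → ℝ} (hg : Continuous g) :
    ∫ s in (0 : ℝ)..1, g (peanoX s) = ∫ s in (0 : ℝ)..1, g s := by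
  rw [← sub_eq_zero, ← abs_nonpos_iff]
  refine le_of_forall_pos_le_add fun ε hε => ?_
  obtain ⟨δ, hδ, modulus⟩ := Metric.uniformContinuousOn_iff_le.1
    (isCompact_Icc.uniformContinuousOn_of_continuous hg.continuousOn) ε hε
  obtain ⟨m, hm⟩ := exists_pow_lt_of_lt_one hδ (show (1 / 3 : ℝ) < 1 by norm_num)
  rw [zero_add]
  exact abs_integral_comp_peanoX_sub_le m hg fun y hy z hz h =>
    modulus y hy z hz (h.trans hm.le)

theorem aemeasurable_peanoX : AEMeasurable peanoX (volume.restrict (Ioc 0 1)) :=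
  (continuousOn_peanoX.mono Ioc_subset_Icc_self).aemeasurable measurableSet_Ioc

theorem map_peanoX : (volume.restrict (Ioc (0 : ℝ) 1)).map peanoX = volume.restrict (Ioc 0 1) := by
  refine ext_of_forall_integral_eq_of_IsFiniteMeasure fun g => ?_
  rw [integral_map aemeasurable_peanoX g.continuous.aestronglyMeasurable,
    ← intervalIntegral.integral_of_le zero_le_one, ← intervalIntegral.integral_of_le zero_le_one]
  exact integral_comp_peanoX g.continuous

/-! ### Local times -/

section LocalTime

variable {f : ℝ → ℝ} {t : ℝ}

theorem exists_isLocalTime_of_absolutelyContinuous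
    (hf : AEMeasurable f (volume.restrict (Ioc 0 1)))
    (hac : (volume.restrict (Ioc (0 : ℝ) 1)).map f ≪ volume) : ∃ L, IsLocalTime f L := by
  have restrict_le : ∀ t ∈ Icc (0 : ℝ) 1,
      volume.restrict (Ioc (0 : ℝ) t) ≤ volume.restrict (Ioc (0 : ℝ) 1) := fun t ht =>
    Measure.restrict_mono (Ioc_subset_Ioc_right ht.2) le_rfl
  refine ⟨fun t z => (((volume.restrict (Ioc (0 : ℝ) t)).map f).rnDeriv volume z).toReal,
    fun t _ z => ENNReal.toReal_nonneg, fun t _ => (Measure.measurable_rnDeriv _ _).ennreal_toReal,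
    fun t _ => Measure.integrable_toReal_rnDeriv, fun t ht g hg _ => ?_⟩
  have hft := hf.mono_measure (restrict_le t ht)
  have hact : (volume.restrict (Ioc (0 : ℝ) t)).map f ≪ volume := by
    refine (Measure.AbsolutelyContinuous.mk fun s hs null => ?_).trans hac
    rw [Measure.map_apply_of_aemeasurable hf hs] at null
    rw [Measure.map_apply_of_aemeasurable hft hs]
    exact (restrict_le t ht).absolutelyContinuous null
  rw [intervalIntegral.integral_of_le ht.1, ← integral_map hft hg.aestronglyMeasurable,
    ← integral_rnDeriv_smul hact]
  simp only [smul_eq_mul, mul_comm]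

theorem exists_isLocalTime_peanoX : ∃ L, IsLocalTime peanoX L := by
  refine exists_isLocalTime_of_absolutelyContinuous aemeasurable_peanoX ?_
  rw [map_peanoX]
  exact Measure.restrict_le_self.absolutelyContinuous

variable {L : ℝ → ℝ → ℝ} {K : Set ℝ} {g : ℝ → ℝ} {B : ℝ}

theorem abs_indicator_le (hB : ∀ z ∈ K, |g z| ≤ B) (hK : K.Nonempty) (z : ℝ) :
    |K.indicator g z| ≤ B := by
  by_cases hz : z ∈ K
  · rw [indicator_of_mem hz]
    exact hB z hz
  · rw [indicator_of_notMem hz, abs_zero]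
    exact (abs_nonneg _).trans (hB _ hK.some_mem)

namespace IsLocalTime

theorem ae_eq_zero_of_notMem (hL : IsLocalTime f L) (ht : t ∈ Icc (0 : ℝ) 1)
    (hK : MeasurableSet K) (hfK : ∀ s ∈ Icc 0 t, f s ∈ K) : ∀ᵐ z, z ∉ K → L t z = 0 := by
  have occupation_compl := hL.occupation t ht (Kᶜ.indicator 1) (measurable_one.indicator hK.compl)
    ⟨1, fun z => by rw [indicator]; split_ifs <;> simp⟩
  have indicator_mul_eq : ∀ z, Kᶜ.indicator (1 : ℝ → ℝ) z * L t z = Kᶜ.indicator (L t) z :=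
    fun z => by by_cases hz : z ∈ Kᶜ <;> simp [hz]
  have time_eq_zero : ∫ s in (0 : ℝ)..t, Kᶜ.indicator (1 : ℝ → ℝ) (f s) = 0 :=
    (intervalIntegral.integral_congr fun s hs => indicator_of_notMem
      (notMem_compl_iff.2 (hfK s (uIcc_of_le ht.1 ▸ hs))) _).trans intervalIntegral.integral_zero
  simp only [time_eq_zero, indicator_mul_eq] at occupation_compl
  have ae_zero := (integral_eq_zero_iff_of_nonneg
    (fun z => indicator_nonneg (fun z _ => hL.nonneg t ht z) z)
    ((hL.integrable t ht).indicator hK.compl)).1 occupation_compl.symm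
  filter_upwards [ae_zero] with z hz hzK
  rwa [indicator_of_mem hzK] at hz

theorem indicator_mul_ae_eq (hL : IsLocalTime f L) (ht : t ∈ Icc (0 : ℝ) 1)
    (hK : MeasurableSet K) (hfK : ∀ s ∈ Icc 0 t, f s ∈ K) :
    (fun z => K.indicator g z * L t z) =ᵐ[volume] fun z => L t z * g z := by
  filter_upwards [hL.ae_eq_zero_of_notMem ht hK hfK] with z hz
  by_cases hzK : z ∈ K
  · rw [indicator_of_mem hzK, mul_comm]
  · rw [hz hzK, mul_zero, zero_mul]

theorem integrable_mul (hL : IsLocalTime f L) (ht : t ∈ Icc (0 : ℝ) 1) (hK : MeasurableSet K)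
    (hfK : ∀ s ∈ Icc 0 t, f s ∈ K) (hg : Measurable g) (hB : ∀ z ∈ K, |g z| ≤ B) :
    Integrable (fun z => L t z * g z) volume :=
  ((hL.integrable t ht).bdd_mul (hg.indicator hK).aestronglyMeasurable (ae_of_all _
    (abs_indicator_le hB ⟨f 0, hfK 0 ⟨le_rfl, ht.1⟩⟩))).congr (hL.indicator_mul_ae_eq ht hK hfK)

theorem integral_mul (hL : IsLocalTime f L) (ht : t ∈ Icc (0 : ℝ) 1) (hK : MeasurableSet K)
    (hfK : ∀ s ∈ Icc 0 t, f s ∈ K) (hg : Measurable g) (hB : ∀ z ∈ K, |g z| ≤ B) :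
    ∫ z, L t z * g z = ∫ s in (0 : ℝ)..t, g (f s) := by
  rw [← integral_congr_ae (hL.indicator_mul_ae_eq ht hK hfK), ← hL.occupation t ht _
    (hg.indicator hK) ⟨B, abs_indicator_le hB ⟨f 0, hfK 0 ⟨le_rfl, ht.1⟩⟩⟩]
  exact intervalIntegral.integral_congr fun s hs =>
    indicator_of_mem (hfK s (uIcc_of_le ht.1 ▸ hs)) g

end IsLocalTime

end LocalTime


theorem mainTheorem3 :
    -- the normalization `φ` and the constants `C`
    (∀ c ∈ Ioo (0 : ℝ) 1,
      0 ≤ peanoPhi c ∧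
      peanoPhi c = 1 / (peanoScale c * (1 - 3 / 4 * (peanoScale c * c)))) ∧
    Tendsto peanoPhi (𝓝[>] 0) (𝓝 0) ∧
    (∀ p : ℝ, 0 < p → ∀ k : ℤ, peanoC ((3 : ℝ) ^ k * p) = peanoC p) ∧
    (∀ n : ℕ, 1 ≤ n → ¬ DifferentiableAt ℝ peanoPhi ((3 : ℝ) ^ (-(n : ℤ)))) ∧
    -- truncated variation
    (∀ p : ℝ, 0 < p → ∀ t ∈ Icc (0 : ℝ) 1,
      Tendsto (fun n : ℕ => ENNReal.ofReal ((3 : ℝ) ^ (-(n : ℤ)) * p) *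
          truncatedVariation peanoX 0 t ((3 : ℝ) ^ (-(n : ℤ)) * p))
        atTop (𝓝 (ENNReal.ofReal (peanoC p * t)))) ∧
    -- the integrals of the crossing numbers make sense
    (∀ g : ℝ → ℝ, Continuous g → ∀ t ∈ Icc (0 : ℝ) 1, ∀ c : ℝ, 0 < c →
      Integrable (fun z => (crossings peanoX z c 0 t : ℝ) * g z) volume) ∧
    -- crossing numbers along `3⁻ⁿ p`, uniformly in `t`
    (∀ p : ℝ, 0 < p → ∀ g : ℝ → ℝ, Continuous g →
      TendstoUniformlyOn
        (fun (n : ℕ) (t : ℝ) => (3 : ℝ) ^ (-(n : ℤ)) * p *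
          ∫ z, (crossings peanoX z ((3 : ℝ) ^ (-(n : ℤ)) * p) 0 t : ℝ) * g z)
        (fun t => peanoC p * ∫ s in (0 : ℝ)..t, g (peanoX s))
        atTop (Icc (0 : ℝ) 1)) ∧
    -- local time as the weak limit of normalized crossing numbers
    (∃ L, IsLocalTime peanoX L) ∧
    (∀ L, IsLocalTime peanoX L → ∀ g : ℝ → ℝ, Continuous g → ∀ t ∈ Icc (0 : ℝ) 1,
      Integrable (fun z => L t z * g z) volume ∧
      Tendsto (fun c : ℝ => ∫ z, peanoPhi c * (crossings peanoX z c 0 t : ℝ) * g z)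
        (𝓝[>] 0) (𝓝 (∫ z, L t z * g z))) := by
  refine ⟨fun c hc => ⟨(peanoPhi_pos hc.1).le, peanoPhi_eq hc.1⟩, tendsto_peanoPhi,
    fun p hp k => peanoC_zpow_mul hp k, fun n _ => not_differentiableAt_peanoPhi n,
    fun p hp t ht => tendsto_mul_truncatedVariation_peanoX hp ht,
    fun g hg t ht c hc => integrable_crossings_mul (continuousOn_peanoX_Icc le_rfl ht.2) ht.1 hc hg,
    fun p hp g hg => tendstoUniformlyOn_mul_integral_crossings_peanoX hp hg,
    exists_isLocalTime_peanoX, fun L hL g hg t ht => ?_⟩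
  obtain ⟨B, hB⟩ := isCompact_Icc.exists_bound_of_continuousOn (s := Icc (0 : ℝ) 1) hg.continuousOn
  have range_mem : ∀ s ∈ Icc 0 t, peanoX s ∈ Icc (0 : ℝ) 1 := fun s _ => peanoX_mem_Icc s
  refine ⟨hL.integrable_mul ht measurableSet_Icc range_mem hg.measurable hB, ?_⟩
  rw [hL.integral_mul ht measurableSet_Icc range_mem hg.measurable hB]
  exact tendsto_integral_peanoPhi_mul_crossings hg ht
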